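/- Let $X$ be the set of finite-support lotteries over $\mathbb{R}$, that is, of mass functions $f_x:\mathbb{R}\to[0,1]$ with finite support $S_x=\{w: f_x(w)>0\}$ and total mass $1$; let $F_x$ be the CDF of $x$, let $F_x^{-1}(q)=\inf\{w: q\le F_x(w)\}$ be its quantile function, and write $x\ge y$ (first-order stochastic dominance) if $F_x(w)\le F_y(w)$ for all $w$. Equip $X$ with the finest topology for which, for every finite $S\subset\mathbb{R}$, the inclusion into $X$ of the simplex $\{x: S_x\subseteq S\}$, with its Euclidean topology, is continuous. Let $\mathcal{D}=\{(x,y)\in X\times X: x\ne y\}$. A binary choice rule is a function $\rho:\mathcal{D}\to[0,1]$ with $\rho(x,y)=1-\rho(y,x)$; the conditions below are required whenever all the values of $\rho$ in them are taken at pairs in $\mathcal{D}$. L1 (Continuity): $\rho$ is continuous on $\mathcal{D}$ (as a subspace of the product $X\times X$). L2 (Independence): $\rho(x,y)=\rho(\lambda x+(1-\lambda)z,\lambda y+(1-\lambda)z)$ for all $x,y,z\in X$ and $\lambda\in(0,1)$. L3 (Moderate Transitivity): if $\rho(x,y)\ge 1/2$ and $\rho(y,z)\ge 1/2$, then either $\rho(x,z)>\min\{\rho(x,y),\rho(y,z)\}$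 or $\rho(x,z)=\rho(x,y)=\rho(y,z)$. L4 (FOSD-Dominance): if $x\ge y$, then $\rho(x,y)\ge\rho(w,z)$ for all $w,z\in X$, with strict inequality if $w\not\ge z$. L5 (Simplification): if $\rho(x,y)\ge 1/2$, then $\rho(x',y)\ge\rho(x,y)$ for every $x'\in X$ with support in $S_x\cup S_y$ and $\rho(x',x)=1/2$ such that, for some $w^*\in S_x\cup S_y$, $F_{x'}(w^*)=F_y(w^*)$ and $F_{x'}(w)\ne F_x(w)$ for at most one $w\in(S_x\cup S_y)\setminus\{w^*\}$. A pair $(G,u)$ is a CDF-complexity representation of $\rho$ if $u:\mathbb{R}\to\mathbb{R}$ is strictly increasing, $G:[-1,1]\to\mathbb{R}$ is continuous and strictly increasing, and for all $(x,y)\in\mathcal{D}$ $$\rho(x,y)=G\left(\frac{EU(x)-EU(y)}{d_{CDF}(x,y)}\right),\qquad EU(x)=\sum_{w}u(w)f_x(w),\qquad d_{CDF}(x,y)=\int_0^1\left|u(F_x^{-1}(q))-u(F_y^{-1}(q))\right|dq .$$ Theorem. A binary choice rule $\rho$ satisfies L1--L5 if and only if it has a CDF-complexity representation. Moreover, if $(G,u)$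 and $(G',u')$ both represent $\rho$, then $G'=G$ on $[-1,1]$ and there are $C>0$ and $b\in\mathbb{R}$ with $u'=Cu+b$. -/

import Mathlib

namespace LotteryChoice

/-- A finite-support lottery over `ℝ`: its mass function `x.weights : ℝ →₀ ℝ` is finitely
supported, nonnegative and sums to `1`. -/
abbrev Lottery : Type := Convexity.StdSimplex ℝ ℝ

/-- The support `S_x = {w | f_x(w) > 0}`. -/
def supp (x : Lottery) : Set ℝ := {w | 0 < x.weights w}

/-- The topology of the lottery domain: the finest one for which the inclusion of every simplex
`{x | supp x ⊆ S}`, `S` finite, with its Euclidean topology (convergence of each probability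
`f_x(w)`), is continuous. A set of lotteries is open iff its trace on each of these simplices is
relatively open. (In the topology of weak convergence, which is coarser, expected utility fails
to be continuous as soon as `u` is unbounded or discontinuous.) -/
instance instTopologicalSpaceLottery : TopologicalSpace Lottery :=
  ⨆ S : Finset ℝ,
    TopologicalSpace.coinduced (Subtype.val : {x : Lottery // supp x ⊆ (S : Set ℝ)} → Lottery)
      (TopologicalSpace.induced (fun x (w : ℝ) => x.1.weights w) Pi.topologicalSpace)

/-- The mixture `t x + (1 - t) z`. -/
noncomputable def mix (t : ℝ) (ht : t ∈ Set.Ioo (0 : ℝ) 1) (x z : Lottery) : Lottery :=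
  Convexity.convexCombPair t (1 - t) ht.1.le (sub_nonneg.2 ht.2.le) (add_sub_cancel t 1) x z

/-- The CDF `F_x(w) = ∑_{v ≤ w} f_x(v)`. -/
noncomputable def cdf (x : Lottery) (w : ℝ) : ℝ :=
  ∑ v ∈ x.weights.support with v ≤ w, x.weights v

/-- The quantile function `F_x⁻¹(q) = inf {w | q ≤ F_x(w)}`, for `0 < q ≤ 1`. -/
noncomputable def quantile (x : Lottery) (q : ℝ) : ℝ := sInf {w | q ≤ cdf x w}

/-- Expected utility `EU(x) = ∑_w u(w) f_x(w)`. -/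
noncomputable def expectedUtility (u : ℝ → ℝ) (x : Lottery) : ℝ :=
  ∑ w ∈ x.weights.support, u w * x.weights w

/-- The CDF distance `∫₀¹ |u(F_x⁻¹(q)) - u(F_y⁻¹(q))| dq`. -/
noncomputable def cdfDist (u : ℝ → ℝ) (x y : Lottery) : ℝ :=
  ∫ q in (0 : ℝ)..1, |u (quantile x q) - u (quantile y q)|

/-- First-order stochastic dominance `x ≥ y`. -/
def FOSD (x y : Lottery) : Prop := ∀ w, cdf x w ≤ cdf y w

/-- A binary choice rule is a function on the pairs of distinct lotteries with values in `[0,1]`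
and `ρ(x,y) = 1 - ρ(y,x)`. The values of `ρ` on the diagonal play no role. -/
def IsBinaryChoiceRule (ρ : Lottery → Lottery → ℝ) : Prop :=
  ∀ x y, x ≠ y → ρ x y ∈ Set.Icc (0 : ℝ) 1 ∧ ρ x y = 1 - ρ y x

/-- Continuity of `ρ` on its domain, the set of pairs of distinct lotteries. -/
def Continuity (ρ : Lottery → Lottery → ℝ) : Prop :=
  ContinuousOn (fun p : Lottery × Lottery => ρ p.1 p.2) {p | p.1 ≠ p.2}

def Independence (ρ : Lottery → Lottery → ℝ) : Prop :=
  ∀ (x y z : Lottery) (t : ℝ) (ht : t ∈ Set.Ioo (0 : ℝ) 1), x ≠ y →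
    ρ x y = ρ (mix t ht x z) (mix t ht y z)

def ModerateTransitivity (ρ : Lottery → Lottery → ℝ) : Prop :=
  ∀ x y z, x ≠ y → y ≠ z → x ≠ z → 1 / 2 ≤ ρ x y → 1 / 2 ≤ ρ y z →
    min (ρ x y) (ρ y z) < ρ x z ∨ (ρ x z = ρ x y ∧ ρ x y = ρ y z)

def Dominance (ρ : Lottery → Lottery → ℝ) : Prop :=
  ∀ x y, x ≠ y → FOSD x y → ∀ w z, w ≠ z →
    ρ w z ≤ ρ x y ∧ (¬ FOSD w z → ρ w z < ρ x y)

def Simplification (ρ : Lottery → Lottery → ℝ) : Prop :=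
  ∀ x y, x ≠ y → 1 / 2 ≤ ρ x y →
    ∀ x', supp x' ⊆ supp x ∪ supp y →
      (∃ w₀ ∈ supp x ∪ supp y, cdf x' w₀ = cdf y w₀ ∧
        {w ∈ (supp x ∪ supp y) \ {w₀} | cdf x' w ≠ cdf x w}.Subsingleton) →
      x' ≠ x → x' ≠ y → ρ x' x = 1 / 2 → ρ x y ≤ ρ x' y

/-- `(G, u)` is a CDF-complexity representation of `ρ`. The ratio `(EU(x) - EU(y)) / d_CDF(x,y)`
takes its values in `[-1,1]`, which is the domain of `G`. -/
structure IsCDFRepresentation (ρ : Lottery → Lottery → ℝ) (G u : ℝ → ℝ) : Prop where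
  strictMono_utility : StrictMono u
  continuousOn : ContinuousOn G (Set.Icc (-1) 1)
  strictMonoOn : StrictMonoOn G (Set.Icc (-1) 1)
  eq : ∀ x y, x ≠ y →
    ρ x y = G ((expectedUtility u x - expectedUtility u y) / cdfDist u x y)

end LotteryChoice

/-! Fix an increasing sequence `w` of prizes through the supports of x and y. With f_i = (F_y(w_i) -
F_x(w_i)) (u(w_{i+1}) - u(w_i)), the expected utility difference is the sum `mass f`, the CDF
distance is the ℓ¹ norm `oneNorm f`, and x ≥ y means f ≥ 0. The theorem thus concerns the ratio
`mass f / oneNorm f` on finitely supported sequences.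

A represented rule satisfies the axioms because this ratio is continuous and homogeneous of degree
0, obeys a min inequality by the triangle inequality (`min_ratio_le_ratio`), equals 1 exactly when f
≥ 0, and does not fall when one coordinate is emptied at constant mass and nonnegative numerator
(`oneNorm_le_of_move`).

Conversely, Independence makes ρ(x,y) a function `score` of the direction of x - y. Transitivity
makes the indifferent directions a subspace; Continuity shows that it has codimension one among the
mass-zero vectors, which yields u (`exists_utility`). In coordinates, Simplification says that
moving one coordinate onto another never lowers the score. Moves between empty coordinates are
reversible, and quasiconcavity then lets coordinates of equal sign merge without changing the score
(`merge_eq`). Every f reduces to its total positive and negative parts (`collect_eq`), so the score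
depends on the ratio alone. The resulting G is strictly increasing because adding a dominant
direction strictly raises a smaller score (`link_lt_link`).

For uniqueness, indifference fixes the kernel of expected utility, hence u up to affine maps; every
ratio in [-1,1] is attained, which fixes G. -/

namespace LotteryChoice

section

open Finset

/-! ### Linear functionals -/

/-- The sum of the values of a finitely supported function. -/
noncomputable def mass {ι : Type*} : (ι →₀ ℝ) →ₗ[ℝ] ℝ := Finsupp.linearCombination ℝ fun _ => (1 : ℝ)

/-- The cumulative sum of a finitely supported function at `z`. -/
noncomputable def cum (z : ℝ) : (ℝ →₀ ℝ) →ₗ[ℝ] ℝ :=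
  Finsupp.linearCombination ℝ fun a => if a ≤ z then (1 : ℝ) else 0

/-- The `ℓ¹` norm of a finitely supported sequence. -/
noncomputable def oneNorm (f : ℕ →₀ ℝ) : ℝ := f.sum fun _ a => |a|

theorem mass_eq_sum {ι : Type*} (f : ι →₀ ℝ) : mass f = f.sum fun _ a => a := by
  simp [mass, Finsupp.linearCombination_apply]

@[simp] theorem mass_single {ι : Type*} (i : ι) (a : ℝ) : mass (Finsupp.single i a) = a := by
  simp [mass]

theorem cum_single (z a c : ℝ) : cum z (Finsupp.single a c) = if a ≤ z then c else 0 := by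
  simp [cum]

theorem mass_weights (x : Lottery) : mass x.weights = 1 := by
  rw [mass_eq_sum]; exact x.total

theorem mass_sub_weights (x y : Lottery) : mass (x.weights - y.weights) = 0 := by
  simp [mass_weights]

theorem weights_nonneg (x : Lottery) (a : ℝ) : 0 ≤ x.weights a := x.nonneg a

theorem supp_eq (x : Lottery) : supp x = ↑x.weights.support := by
  ext a
  simp only [supp, Set.mem_ofPred_eq, mem_coe, Finsupp.mem_support_iff]
  exact ⟨fun h => h.ne', fun h => lt_of_le_of_ne (weights_nonneg x a) (Ne.symm h)⟩

theorem cdf_eq_cum (x : Lottery) (z : ℝ) : cdf x z = cum z x.weights := by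
  simp [cdf, cum, Finsupp.linearCombination_apply, Finsupp.sum, sum_filter]

theorem expectedUtility_eq (u : ℝ → ℝ) (x : Lottery) :
    expectedUtility u x = Finsupp.linearCombination ℝ u x.weights := by
  simp [expectedUtility, Finsupp.linearCombination_apply, Finsupp.sum, mul_comm]

theorem oneNorm_eq_sum_range {f : ℕ →₀ ℝ} {n : ℕ} (h : f.support ⊆ range n) :
    oneNorm f = ∑ i ∈ range n, |f i| :=
  Finsupp.sum_of_support_subset _ h _ (by simp)

theorem exists_support_subset_range (f : ℕ →₀ ℝ) : ∃ n, f.support ⊆ range n :=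
  f.support.exists_nat_subset_range

theorem exists_support_subset_range₂ (f h : ℕ →₀ ℝ) :
    ∃ n, f.support ⊆ range n ∧ h.support ⊆ range n := by
  obtain ⟨n, hn⟩ := (f.support ∪ h.support).exists_nat_subset_range
  exact ⟨n, subset_union_left.trans hn, subset_union_right.trans hn⟩

theorem oneNorm_smul (c : ℝ) (f : ℕ →₀ ℝ) : oneNorm (c • f) = |c| * oneNorm f := by
  obtain ⟨n, hn⟩ := exists_support_subset_range f
  rw [oneNorm_eq_sum_range hn, oneNorm_eq_sum_range (Finsupp.support_smul.trans hn), mul_sum]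
  simp [abs_mul]

theorem oneNorm_add_le (f h : ℕ →₀ ℝ) : oneNorm (f + h) ≤ oneNorm f + oneNorm h := by
  obtain ⟨n, hf, hh⟩ := exists_support_subset_range₂ f h
  rw [oneNorm_eq_sum_range hf, oneNorm_eq_sum_range hh,
    oneNorm_eq_sum_range (Finsupp.support_add.trans (union_subset hf hh)), ← sum_add_distrib]
  exact sum_le_sum fun i _ => abs_add_le _ _

theorem oneNorm_pos {f : ℕ →₀ ℝ} (h : f ≠ 0) : 0 < oneNorm f := by
  refine sum_pos (fun i hi => abs_pos.2 (Finsupp.mem_support_iff.1 hi)) ?_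
  exact Finsupp.support_nonempty_iff.2 h

theorem abs_mass_le_oneNorm (f : ℕ →₀ ℝ) : |mass f| ≤ oneNorm f := by
  rw [mass_eq_sum]; exact abs_sum_le_sum_abs _ _

theorem oneNorm_single (i : ℕ) (a : ℝ) : oneNorm (Finsupp.single i a) = |a| := by
  simp [oneNorm]

theorem oneNorm_add_single {f : ℕ →₀ ℝ} {i : ℕ} (h : f i = 0) (a : ℝ) :
    oneNorm (f + Finsupp.single i a) = oneNorm f + |a| := by
  classical
  unfold oneNorm
  rw [Finsupp.sum_add_index_of_disjoint]
  · simp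
  · rw [disjoint_left]
    intro k hk hk'
    have : k = i := by simpa using Finsupp.support_single_subset hk'
    exact Finsupp.mem_support_iff.1 hk (this ▸ h)

theorem nonneg_of_mass_eq_oneNorm {f : ℕ →₀ ℝ} (h : mass f = oneNorm f) (i : ℕ) : 0 ≤ f i := by
  rw [mass_eq_sum] at h
  have h' := (sum_eq_sum_iff_of_le (s := f.support) (f := fun i => f i) (g := fun i => |f i|)
    fun i _ => le_abs_self _).1 h
  by_cases hi : i ∈ f.support
  · rw [h' i hi]; exact abs_nonneg _
  · rw [Finsupp.notMem_support_iff.1 hi]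

theorem mass_eq_oneNorm {f : ℕ →₀ ℝ} (h : ∀ i, 0 ≤ f i) : mass f = oneNorm f := by
  rw [mass_eq_sum]
  exact sum_congr rfl fun i _ => (abs_of_nonneg (h i)).symm

/-! ### Coordinates along an increasing sequence of prizes -/

/-- The utility increment of the `i`-th interval of the sequence `w`. -/
def gap (u : ℝ → ℝ) (w : ℕ → ℝ) (i : ℕ) : ℝ := u (w (i + 1)) - u (w i)

/-- The combination with coefficients `f` of the shifts of mass across the intervals of `w`, each
normalized to a unit change of expected utility. -/
noncomputable def shift (u : ℝ → ℝ) (w : ℕ → ℝ) : (ℕ →₀ ℝ) →ₗ[ℝ] (ℝ →₀ ℝ) :=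
  Finsupp.linearCombination ℝ fun i =>
    (gap u w i)⁻¹ • (Finsupp.single (w (i + 1)) (1 : ℝ) - Finsupp.single (w i) 1)

variable {u : ℝ → ℝ} {w : ℕ → ℝ}

theorem gap_pos (hu : StrictMono u) (hw : StrictMono w) (i : ℕ) : 0 < gap u w i :=
  sub_pos.2 (hu (hw i.lt_succ_self))

theorem shift_single (i : ℕ) (a : ℝ) : shift u w (Finsupp.single i a) =
    (a * (gap u w i)⁻¹) • (Finsupp.single (w (i + 1)) (1 : ℝ) - Finsupp.single (w i) 1) := by
  rw [shift, Finsupp.linearCombination_single, smul_smul]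

theorem mass_shift (f : ℕ →₀ ℝ) : mass (shift u w f) = 0 := by
  induction f using Finsupp.induction_linear with
  | zero => simp
  | add f g hf hg => simp [hf, hg]
  | single i a => simp [shift_single]

theorem linearCombination_shift (hu : StrictMono u) (hw : StrictMono w) (f : ℕ →₀ ℝ) :
    Finsupp.linearCombination ℝ u (shift u w f) = mass f := by
  induction f using Finsupp.induction_linear with
  | zero => simp
  | add f g hf hg => simp [hf, hg]
  | single i a =>
    have := (gap_pos hu hw i).ne'
    simp only [shift_single, map_smul, map_sub, Finsupp.linearCombination_single, mass_single,
      smul_eq_mul, one_mul]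
    rw [← gap]; field_simp

/-- Only the `i`-th shift carries mass across `w i`: the earlier ones stay weakly below it and the
later ones strictly above. Coordinates can therefore be read off the CDFs. -/
theorem cum_shift (hw : StrictMono w) (f : ℕ →₀ ℝ) (i : ℕ) :
    cum (w i) (shift u w f) = -(f i / gap u w i) := by
  induction f using Finsupp.induction_linear with
  | zero => simp
  | add f g hf hg => simp [hf, hg]; ring
  | single j a =>
    simp only [shift_single, map_smul, map_sub, cum_single, hw.le_iff_le, smul_eq_mul]
    rcases lt_trichotomy i j with h | rfl | h
    · rw [if_neg (by omega), if_neg (by omega), Finsupp.single_eq_of_ne (by omega)]; simp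
    · simp [div_eq_mul_inv]
    · rw [if_pos (by omega), if_pos (by omega), Finsupp.single_eq_of_ne (by omega)]; simp

theorem apply_eq_cum_shift (hu : StrictMono u) (hw : StrictMono w) (f : ℕ →₀ ℝ) (i : ℕ) :
    f i = -cum (w i) (shift u w f) * gap u w i := by
  have := (gap_pos hu hw i).ne'
  rw [cum_shift hw]; field_simp

theorem cum_shift_nonpos (hu : StrictMono u) (hw : StrictMono w) {f : ℕ →₀ ℝ}
    (hf : ∀ i, 0 ≤ f i) (z : ℝ) : cum z (shift u w f) ≤ 0 := by
  rw [shift, Finsupp.linearCombination_apply, Finsupp.sum, map_sum]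
  refine sum_nonpos fun i _ => ?_
  rw [map_smul, map_smul, map_sub, cum_single, cum_single, smul_eq_mul, smul_eq_mul]
  refine mul_nonpos_of_nonneg_of_nonpos (hf i)
    (mul_nonpos_of_nonneg_of_nonpos (inv_nonneg.2 (gap_pos hu hw i).le) ?_)
  have := hw i.lt_succ_self
  split_ifs <;> linarith

theorem shift_injective (hu : StrictMono u) (hw : StrictMono w) :
    Function.Injective (shift u w) := by
  intro f g h
  ext i
  rw [apply_eq_cum_shift hu hw f, apply_eq_cum_shift hu hw g, h]

theorem support_shift_subset (f : ℕ →₀ ℝ) : ↑(shift u w f).support ⊆ Set.range w := by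
  classical
  rw [← Finsupp.mem_supported ℝ]
  induction f using Finsupp.induction_linear with
  | zero => simp
  | add f g hf hg => rw [map_add]; exact Submodule.add_mem _ hf hg
  | single i a =>
    rw [shift_single]
    exact Submodule.smul_mem _ _ (Submodule.sub_mem _
      (Finsupp.single_mem_supported _ _ (Set.mem_range_self _))
      (Finsupp.single_mem_supported _ _ (Set.mem_range_self _)))

theorem single_sub_single_mem_range_shift (hu : StrictMono u) (hw : StrictMono w) (k : ℕ) :
    Finsupp.single (w k) (1 : ℝ) - Finsupp.single (w 0) 1 ∈ LinearMap.range (shift u w) := by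
  induction k with
  | zero => simp
  | succ k ih =>
    have h : Finsupp.single (w (k + 1)) (1 : ℝ) - Finsupp.single (w k) 1
        ∈ LinearMap.range (shift u w) :=
      ⟨Finsupp.single k (gap u w k), by
        rw [shift_single, mul_inv_cancel₀ (gap_pos hu hw k).ne', one_smul]⟩
    have := Submodule.add_mem _ h ih
    rwa [sub_add_sub_cancel] at this

theorem eq_sum_single_sub {v : ℝ →₀ ℝ} (hv : mass v = 0) (b : ℝ) :
    v = ∑ a ∈ v.support, v a • (Finsupp.single a (1 : ℝ) - Finsupp.single b 1) := by
  simp only [smul_sub, sum_sub_distrib, Finsupp.smul_single, smul_eq_mul, mul_one]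
  rw [mass_eq_sum] at hv
  have h1 : ∑ a ∈ v.support, Finsupp.single a (v a) = v := v.sum_single
  have h2 : ∑ a ∈ v.support, v a = 0 := hv
  rw [h1, ← Finsupp.single_finsetSum, h2]
  simp

theorem exists_shift_eq (hu : StrictMono u) (hw : StrictMono w) {v : ℝ →₀ ℝ}
    (hv : ↑v.support ⊆ Set.range w) (h0 : mass v = 0) : ∃ f, shift u w f = v := by
  change v ∈ LinearMap.range (shift u w)
  rw [eq_sum_single_sub h0 (w 0)]
  refine Submodule.sum_mem _ fun a ha => Submodule.smul_mem _ _ ?_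
  obtain ⟨k, rfl⟩ := hv (mem_coe.2 ha)
  exact single_sub_single_mem_range_shift hu hw k

theorem exists_strictMono_cover (S : Finset ℝ) :
    ∃ (w : ℕ → ℝ) (n : ℕ), StrictMono w ∧ S = (range n).image w := by
  classical
  induction S using Finset.induction_on_max with
  | empty => exact ⟨fun i => i, 0, Nat.strictMono_cast, by simp⟩
  | insert a S ha ih =>
    obtain ⟨w, n, hw, rfl⟩ := ih
    have hlt : ∀ i < n, w i < a := fun i hi => ha _ (mem_image_of_mem _ (mem_range.2 hi))
    -- Beyond the old points the sequence runs a, a + 1, a + 2, ..., so that it is defined on all of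
    -- ℕ.
    refine ⟨fun i => if i < n then w i else a + ((i : ℝ) - n), n + 1, strictMono_nat_of_lt_succ ?_, ?_⟩
    · intro i
      rcases lt_trichotomy (i + 1) n with h | h | h
      · simp only [h, (Nat.lt_succ_self i).trans h, if_true]; exact hw i.lt_succ_self
      · have : i < n := by omega
        simp only [this, if_true, h, lt_irrefl, if_false]
        rw [← h]; simpa using hlt i this
      · simp only [show ¬ i + 1 < n by omega, show ¬ i < n by omega, if_false]
        push_cast; linarith
    · rw [range_add_one, image_insert]
      simp only [lt_irrefl, if_false, sub_self, add_zero]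
      congr 1
      exact image_congr fun i hi => by simp [mem_range.1 (mem_coe.1 hi)]

/-- A strictly increasing sequence through all points of a finite set. -/
theorem exists_strictMono_subset_range (S : Finset ℝ) :
    ∃ w : ℕ → ℝ, StrictMono w ∧ ↑S ⊆ Set.range w := by
  obtain ⟨w, n, hw, rfl⟩ := exists_strictMono_cover S
  exact ⟨w, hw, by simp⟩

/-! ### Expected utility and dominance in coordinates -/

theorem support_sub_subset_range {x y : Lottery} (hx : supp x ⊆ Set.range w)
    (hy : supp y ⊆ Set.range w) : ↑(x.weights - y.weights).support ⊆ Set.range w := by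
  classical
  rw [supp_eq] at hx hy
  refine Set.Subset.trans (coe_subset.2 Finsupp.support_sub) ?_
  rw [coe_union]
  exact Set.union_subset hx hy

theorem exists_shift_eq_sub (hu : StrictMono u) (hw : StrictMono w) {x y : Lottery}
    (hx : supp x ⊆ Set.range w) (hy : supp y ⊆ Set.range w) :
    ∃ f, shift u w f = x.weights - y.weights :=
  exists_shift_eq hu hw (support_sub_subset_range hx hy) (mass_sub_weights x y)

theorem expectedUtility_sub (hu : StrictMono u) (hw : StrictMono w) {x y : Lottery} {f : ℕ →₀ ℝ}
    (h : shift u w f = x.weights - y.weights) :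
    expectedUtility u x - expectedUtility u y = mass f := by
  rw [expectedUtility_eq, expectedUtility_eq, ← map_sub, ← h, linearCombination_shift hu hw]

theorem fosd_iff (hu : StrictMono u) (hw : StrictMono w) {x y : Lottery} {f : ℕ →₀ ℝ}
    (h : shift u w f = x.weights - y.weights) : FOSD x y ↔ ∀ i, 0 ≤ f i := by
  have key : ∀ z, cdf x z - cdf y z = cum z (shift u w f) := fun z => by
    rw [cdf_eq_cum, cdf_eq_cum, ← map_sub, h]
  constructor
  · intro hxy i
    rw [apply_eq_cum_shift hu hw, ← key]
    exact mul_nonneg (neg_nonneg.2 (sub_nonpos.2 (hxy _))) (gap_pos hu hw i).le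
  · intro hf z
    rw [← sub_nonpos, key]
    exact cum_shift_nonpos hu hw hf z

theorem shift_sub_ne_zero {x y : Lottery} {f : ℕ →₀ ℝ} (h : shift u w f = x.weights - y.weights)
    (hxy : x ≠ y) : f ≠ 0 := by
  rintro rfl
  rw [map_zero] at h
  exact hxy (Convexity.StdSimplex.weights_inj.1 (sub_eq_zero.1 h.symm))

end

section

open Finset

variable {u : ℝ → ℝ} {w : ℕ → ℝ}

/-! ### The CDF distance in coordinates -/

theorem cdf_mono (x : Lottery) : Monotone (cdf x) := by
  intro a b hab
  refine sum_le_sum_of_subset_of_nonneg ?_ fun i _ _ => weights_nonneg x i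
  intro i hi
  rw [mem_filter] at hi ⊢
  exact ⟨hi.1, hi.2.trans hab⟩

theorem cdf_nonneg (x : Lottery) (z : ℝ) : 0 ≤ cdf x z :=
  sum_nonneg fun i _ => weights_nonneg x i

theorem cdf_eq_one {x : Lottery} {z : ℝ} (h : ∀ a ∈ supp x, a ≤ z) : cdf x z = 1 := by
  rw [supp_eq] at h
  rw [cdf, filter_true_of_mem fun a ha => h a (mem_coe.2 ha)]
  exact x.total

theorem cdf_le_one (x : Lottery) (z : ℝ) : cdf x z ≤ 1 := by
  rw [← mass_weights x, mass_eq_sum]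
  exact sum_le_sum_of_subset_of_nonneg (filter_subset _ _) fun i _ _ => weights_nonneg x i

theorem exists_mem_supp_cdf_eq {x : Lottery} {z : ℝ} (h : 0 < cdf x z) :
    ∃ m ∈ supp x, m ≤ z ∧ cdf x m = cdf x z := by
  set T := x.weights.support.filter (· ≤ z) with hT
  have hne : T.Nonempty := by
    rw [nonempty_iff_ne_empty]
    intro h0
    rw [cdf, ← hT, h0] at h
    simp at h
  have hm := T.max'_mem hne
  replace hm := mem_filter.1 hm
  refine ⟨T.max' hne, by rw [supp_eq]; exact hm.1, hm.2, ?_⟩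
  unfold cdf
  congr 1
  ext a
  rw [mem_filter, mem_filter]
  refine and_congr_right fun ha => ⟨fun h => h.trans hm.2, fun h => T.le_max' a ?_⟩
  rw [hT, mem_filter]
  exact ⟨ha, h⟩

/-- The CDF jumps only at support points, so the infimum is attained at one. At q = 0 this fails,
since every real qualifies. -/
theorem exists_isLeast_quantile (x : Lottery) {q : ℝ} (h0 : 0 < q) (h1 : q ≤ 1) :
    ∃ m ∈ supp x, IsLeast {z | q ≤ cdf x z} m := by
  set T := x.weights.support.filter (q ≤ cdf x ·) with hT
  have key : ∀ z, q ≤ cdf x z → ∃ m ∈ T, m ≤ z := fun z hz => by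
    obtain ⟨m, hm, hmz, he⟩ := exists_mem_supp_cdf_eq (h0.trans_le hz)
    rw [supp_eq] at hm
    exact ⟨m, by rw [hT, mem_filter]; exact ⟨hm, he ▸ hz⟩, hmz⟩
  have hne : T.Nonempty := by
    obtain ⟨M, hM⟩ := x.weights.support.bddAbove
    obtain ⟨m, hm, -⟩ := key M (by
      rw [cdf_eq_one]
      · exact h1
      · rw [supp_eq]; exact hM)
    exact ⟨m, hm⟩
  have hm := T.min'_mem hne
  replace hm := mem_filter.1 hm
  refine ⟨T.min' hne, by rw [supp_eq]; exact hm.1, hm.2, fun z hz => ?_⟩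
  obtain ⟨m, hmT, hmz⟩ := key z hz
  exact (T.min'_le m hmT).trans hmz

theorem quantile_mem_supp (x : Lottery) {q : ℝ} (h0 : 0 < q) (h1 : q ≤ 1) :
    quantile x q ∈ supp x := by
  obtain ⟨m, hm, hl⟩ := exists_isLeast_quantile x h0 h1
  rwa [quantile, hl.csInf_eq]

theorem lt_quantile_iff (x : Lottery) {q : ℝ} (h0 : 0 < q) (h1 : q ≤ 1) (z : ℝ) :
    z < quantile x q ↔ cdf x z < q := by
  obtain ⟨m, hm, hl⟩ := exists_isLeast_quantile x h0 h1
  rw [quantile, hl.csInf_eq, ← not_le, ← not_le, not_iff_not]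
  exact ⟨fun h => hl.1.trans (cdf_mono x h), fun h => hl.2 h⟩

/-- Telescoping: the two indicators differ exactly on the intervals between `w l` and `w k`. -/
theorem abs_sub_eq_sum_gap (hu : StrictMono u) (hw : StrictMono w) {n k l : ℕ} (hk : k ≤ n)
    (hl : l ≤ n) : |u (w k) - u (w l)| =
      ∑ i ∈ range n, |(if i < k then (1 : ℝ) else 0) - if i < l then 1 else 0| * gap u w i := by
  wlog h : l ≤ k generalizing k l
  · rw [abs_sub_comm, this hl hk (by omega)]
    exact sum_congr rfl fun i _ => by rw [abs_sub_comm]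
  have hI : ∑ i ∈ Ico l k, gap u w i = u (w k) - u (w l) :=
    sum_Ico_sub (fun i => u (w i)) h
  rw [abs_of_nonneg (sub_nonneg.2 (hu.monotone (hw.monotone h))), ← hI]
  have hs : Ico l k ⊆ range n := fun i hi => by
    rw [mem_Ico] at hi; rw [mem_range]; omega
  rw [← sum_subset hs]
  · refine sum_congr rfl fun i hi => ?_
    rw [mem_Ico] at hi
    rw [if_pos hi.2, if_neg (by omega)]; simp
  · intro i _ hi
    rw [mem_Ico] at hi
    by_cases h1 : i < l
    · rw [if_pos h1, if_pos (by omega)]; simp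
    · rw [if_neg h1, if_neg (by omega)]; simp

theorem integral_abs_indicator_sub {a b : ℝ} (ha : a ∈ Set.Icc (0 : ℝ) 1)
    (hb : b ∈ Set.Icc (0 : ℝ) 1) :
    IntervalIntegrable (fun q : ℝ => |(if a < q then (1 : ℝ) else 0) - if b < q then 1 else 0|)
        MeasureTheory.volume 0 1 ∧
      ∫ q in (0 : ℝ)..1, |(if a < q then (1 : ℝ) else 0) - if b < q then 1 else 0| = |a - b| := by
  wlog h : a ≤ b generalizing a b
  · have := this hb ha (by linarith)
    simpa only [abs_sub_comm] using this
  have he : (fun q : ℝ => |(if a < q then (1 : ℝ) else 0) - if b < q then 1 else 0|) =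
      Set.indicator (Set.Ioc a b) fun _ => (1 : ℝ) := by
    funext q
    by_cases hq : q ∈ Set.Ioc a b
    · rw [Set.indicator_of_mem hq, if_pos hq.1, if_neg (not_lt.2 hq.2)]; simp
    · rw [Set.indicator_of_notMem hq]
      by_cases h1 : a < q
      · have : b < q := by by_contra h2; exact hq ⟨h1, not_lt.1 h2⟩
        simp [h1, this]
      · have : ¬ b < q := fun h2 => h1 (h.trans_lt h2)
        simp [h1, this]
  rw [he]
  constructor
  · rw [intervalIntegrable_iff, Set.uIoc_of_le zero_le_one]
    exact (MeasureTheory.integrable_const _).indicator measurableSet_Ioc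
  · rw [intervalIntegral.integral_of_le zero_le_one,
      MeasureTheory.setIntegral_indicator measurableSet_Ioc,
      Set.inter_eq_self_of_subset_right (Set.Ioc_subset_Ioc ha.1 hb.2)]
    simp [h, abs_of_nonpos (sub_nonpos.2 h)]

theorem cdf_mem_Icc (x : Lottery) (z : ℝ) : cdf x z ∈ Set.Icc (0 : ℝ) 1 :=
  ⟨cdf_nonneg x z, cdf_le_one x z⟩

theorem exists_index_bound (hw : StrictMono w) (x : Lottery) : ∃ n, ∀ i, w i ∈ supp x → i < n := by
  obtain ⟨n, hn⟩ := (x.weights.support.preimage w hw.injective.injOn).exists_nat_subset_range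
  refine ⟨n, fun i hi => mem_range.1 (hn ?_)⟩
  rw [mem_preimage]
  rw [supp_eq] at hi
  exact hi

/-- Layer-cake argument: `w i` lies below the quantile at q iff `cdf x (w i) < q`, so the integrand
is a finite sum of gaps weighted by differences of indicators in q, each integrating to a CDF
difference. -/
theorem cdfDist_eq_sum (hu : StrictMono u) (hw : StrictMono w) {x y : Lottery}
    (hx : supp x ⊆ Set.range w) (hy : supp y ⊆ Set.range w) {n : ℕ}
    (hxn : ∀ i, w i ∈ supp x → i ≤ n) (hyn : ∀ i, w i ∈ supp y → i ≤ n) :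
    cdfDist u x y = ∑ i ∈ range n, |cdf x (w i) - cdf y (w i)| * gap u w i := by
  have hpt : ∀ q ∈ Set.Ioc (0 : ℝ) 1, |u (quantile x q) - u (quantile y q)| =
      ∑ i ∈ range n, |(if cdf x (w i) < q then (1 : ℝ) else 0) - if cdf y (w i) < q then 1 else 0| *
        gap u w i := by
    intro q hq
    have h1 := quantile_mem_supp x hq.1 hq.2
    have h2 := quantile_mem_supp y hq.1 hq.2
    have h3 := lt_quantile_iff x hq.1 hq.2
    have h4 := lt_quantile_iff y hq.1 hq.2
    obtain ⟨k, hk⟩ := hx h1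
    obtain ⟨l, hl⟩ := hy h2
    rw [← hk] at h1 h3 ⊢
    rw [← hl] at h2 h4 ⊢
    rw [abs_sub_eq_sum_gap hu hw (hxn k h1) (hyn l h2)]
    refine sum_congr rfl fun i _ => ?_
    simp only [← h3, ← h4, hw.lt_iff_lt]
  have hI : ∀ i, _ := fun i => integral_abs_indicator_sub (cdf_mem_Icc x (w i)) (cdf_mem_Icc y (w i))
  -- Agreement on the open interval suffices, which avoids the degenerate quantile at q = 0.
  rw [cdfDist, intervalIntegral.integral_congr_uIoo (g := fun q => ∑ i ∈ range n,
    |(if cdf x (w i) < q then (1 : ℝ) else 0) - if cdf y (w i) < q then 1 else 0| * gap u w i),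
    intervalIntegral.integral_finsetSum fun i _ => (hI i).1.mul_const _]
  · exact sum_congr rfl fun i _ => by rw [intervalIntegral.integral_mul_const, (hI i).2]
  · intro q hq
    rw [Set.uIoo_of_le zero_le_one] at hq
    exact hpt q ⟨hq.1, hq.2.le⟩

theorem cdfDist_eq_oneNorm (hu : StrictMono u) (hw : StrictMono w) {x y : Lottery}
    (hx : supp x ⊆ Set.range w) (hy : supp y ⊆ Set.range w) {f : ℕ →₀ ℝ}
    (h : shift u w f = x.weights - y.weights) : cdfDist u x y = oneNorm f := by
  obtain ⟨n₁, h₁⟩ := exists_index_bound hw x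
  obtain ⟨n₂, h₂⟩ := exists_index_bound hw y
  obtain ⟨n₃, h₃⟩ := exists_support_subset_range f
  set n := n₁ + n₂ + n₃
  rw [oneNorm_eq_sum_range (n := n) (h₃.trans (range_subset_range.2 (by omega))),
    cdfDist_eq_sum hu hw hx hy (n := n) (fun i hi => by have := h₁ i hi; omega)
      (fun i hi => by have := h₂ i hi; omega)]
  refine sum_congr rfl fun i _ => ?_
  rw [apply_eq_cum_shift hu hw f i, h, map_sub, ← cdf_eq_cum, ← cdf_eq_cum, abs_mul, abs_neg,
    abs_of_pos (gap_pos hu hw i)]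

/-- The argument of the representation. -/
noncomputable def ratio (u : ℝ → ℝ) (x y : Lottery) : ℝ :=
  (expectedUtility u x - expectedUtility u y) / cdfDist u x y

theorem ratio_eq (hu : StrictMono u) (hw : StrictMono w) {x y : Lottery}
    (hx : supp x ⊆ Set.range w) (hy : supp y ⊆ Set.range w) {f : ℕ →₀ ℝ}
    (h : shift u w f = x.weights - y.weights) : ratio u x y = mass f / oneNorm f := by
  rw [ratio, expectedUtility_sub hu hw h, cdfDist_eq_oneNorm hu hw hx hy h]

/-- Any finite family of lotteries is supported on a common increasing sequence. -/
theorem exists_strictMono_supp_subset (s : Finset Lottery) :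
    ∃ w : ℕ → ℝ, StrictMono w ∧ ∀ x ∈ s, supp x ⊆ Set.range w := by
  classical
  obtain ⟨w, hw, h⟩ := exists_strictMono_subset_range (s.biUnion fun x => x.weights.support)
  refine ⟨w, hw, fun x hx => ?_⟩
  rw [supp_eq]
  exact (coe_subset.2 (subset_biUnion_of_mem (fun x : Lottery => x.weights.support) hx)).trans h

theorem exists_coordinates (hu : StrictMono u) (x y : Lottery) :
    ∃ (w : ℕ → ℝ) (f : ℕ →₀ ℝ), StrictMono w ∧ supp x ⊆ Set.range w ∧ supp y ⊆ Set.range w ∧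
      shift u w f = x.weights - y.weights := by
  classical
  obtain ⟨w, hw, h⟩ := exists_strictMono_supp_subset {x, y}
  have hx := h x (by simp)
  have hy := h y (by simp)
  obtain ⟨f, hf⟩ := exists_shift_eq_sub hu hw hx hy
  exact ⟨w, f, hw, hx, hy, hf⟩

theorem cdfDist_pos (hu : StrictMono u) {x y : Lottery} (hxy : x ≠ y) : 0 < cdfDist u x y := by
  obtain ⟨w, f, hw, hx, hy, hf⟩ := exists_coordinates hu x y
  rw [cdfDist_eq_oneNorm hu hw hx hy hf]
  exact oneNorm_pos (shift_sub_ne_zero hf hxy)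

theorem abs_expectedUtility_sub_le (hu : StrictMono u) (x y : Lottery) :
    |expectedUtility u x - expectedUtility u y| ≤ cdfDist u x y := by
  obtain ⟨w, f, hw, hx, hy, hf⟩ := exists_coordinates hu x y
  rw [cdfDist_eq_oneNorm hu hw hx hy hf, expectedUtility_sub hu hw hf]
  exact abs_mass_le_oneNorm f

theorem ratio_mem_Icc (hu : StrictMono u) {x y : Lottery} (hxy : x ≠ y) :
    ratio u x y ∈ Set.Icc (-1 : ℝ) 1 := by
  have h := cdfDist_pos hu hxy
  have h' := abs_le.1 (abs_expectedUtility_sub_le hu x y)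
  rw [ratio]
  constructor
  · rw [le_div_iff₀ h]; linarith
  · rw [div_le_one h]; exact h'.2

theorem cdfDist_comm (u : ℝ → ℝ) (x y : Lottery) : cdfDist u x y = cdfDist u y x := by
  simp only [cdfDist, abs_sub_comm]

theorem ratio_swap (u : ℝ → ℝ) (x y : Lottery) : ratio u y x = -ratio u x y := by
  rw [ratio, ratio, cdfDist_comm u y x, ← neg_div, neg_sub]

theorem cdfDist_self (u : ℝ → ℝ) (x : Lottery) : cdfDist u x x = 0 := by
  simp [cdfDist]

theorem cdfDist_triangle (hu : StrictMono u) (x y z : Lottery) :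
    cdfDist u x z ≤ cdfDist u x y + cdfDist u y z := by
  classical
  obtain ⟨w, hw, h⟩ := exists_strictMono_supp_subset {x, y, z}
  have hx := h x (by simp)
  have hy := h y (by simp)
  have hz := h z (by simp)
  obtain ⟨f, hf⟩ := exists_shift_eq_sub hu hw hx hy
  obtain ⟨g, hg⟩ := exists_shift_eq_sub hu hw hy hz
  have hfg : shift u w (f + g) = x.weights - z.weights := by rw [map_add, hf, hg]; abel
  rw [cdfDist_eq_oneNorm hu hw hx hy hf, cdfDist_eq_oneNorm hu hw hy hz hg,
    cdfDist_eq_oneNorm hu hw hx hz hfg]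
  exact oneNorm_add_le f g

theorem ratio_eq_one_iff (hu : StrictMono u) {x y : Lottery} (hxy : x ≠ y) :
    ratio u x y = 1 ↔ FOSD x y := by
  obtain ⟨w, f, hw, hx, hy, hf⟩ := exists_coordinates hu x y
  have hpos := oneNorm_pos (shift_sub_ne_zero hf hxy)
  rw [ratio_eq hu hw hx hy hf, fosd_iff hu hw hf, div_eq_one_iff_eq hpos.ne']
  exact ⟨nonneg_of_mass_eq_oneNorm, mass_eq_oneNorm⟩

end

section

open Finset

variable {ρ : Lottery → Lottery → ℝ} {G u : ℝ → ℝ}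

/-! ### Continuity on the space of lotteries -/

theorem continuous_of_forall_simplex {f : Lottery → ℝ}
    (h : ∀ S : Finset ℝ, ∃ φ : (ℝ → ℝ) → ℝ, Continuous φ ∧
      ∀ x : Lottery, supp x ⊆ S → f x = φ x.weights) : Continuous f := by
  refine continuous_iSup_dom.2 fun S => continuous_coinduced_dom.2 ?_
  obtain ⟨φ, hφ, he⟩ := h S
  have : f ∘ (Subtype.val : {x : Lottery // supp x ⊆ (S : Set ℝ)} → Lottery) =
      φ ∘ fun x (w : ℝ) => x.1.weights w := by
    funext x
    exact he x.1 x.2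
  rw [this]
  exact @Continuous.comp _ _ _ (_) _ _ _ _ hφ continuous_induced_dom

theorem support_subset_of_supp_subset {x : Lottery} {S : Finset ℝ} (h : supp x ⊆ S) :
    x.weights.support ⊆ S := by
  rwa [supp_eq, coe_subset] at h

theorem continuous_expectedUtility (u : ℝ → ℝ) : Continuous (expectedUtility u) := by
  refine continuous_of_forall_simplex fun S => ⟨fun p => ∑ w ∈ S, u w * p w, by fun_prop, ?_⟩
  intro x hx
  refine sum_subset (support_subset_of_supp_subset hx) fun w _ hw => ?_
  rw [Finsupp.notMem_support_iff.1 hw, mul_zero]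

theorem cdf_eq_sum_of_supp_subset {x : Lottery} {S : Finset ℝ} (h : supp x ⊆ S) (z : ℝ) :
    cdf x z = ∑ v ∈ S with v ≤ z, x.weights v := by
  refine sum_subset (filter_subset_filter _ (support_subset_of_supp_subset h)) fun v hv hv' => ?_
  rw [mem_filter] at hv hv'
  exact Finsupp.notMem_support_iff.1 fun h => hv' ⟨h, hv.2⟩

theorem continuous_cdfDist_left (hu : StrictMono u) (y : Lottery) :
    Continuous fun x => cdfDist u x y := by
  classical
  refine continuous_of_forall_simplex fun S => ?_
  obtain ⟨w, n, hw, hS⟩ := exists_strictMono_cover (S ∪ y.weights.support)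
  have hmem : ∀ a ∈ S ∪ y.weights.support, ∃ i < n, w i = a := fun a ha => by
    rw [hS, mem_image] at ha
    obtain ⟨i, hi, h⟩ := ha
    exact ⟨i, mem_range.1 hi, h⟩
  have hlt : ∀ i, w i ∈ S ∪ y.weights.support → i ≤ n := fun i hi => by
    obtain ⟨j, hj, h⟩ := hmem _ hi
    exact hw.injective h ▸ hj.le
  refine ⟨fun p => ∑ i ∈ range n, |(∑ v ∈ S with v ≤ w i, p v) - cdf y (w i)| * gap u w i,
    by fun_prop, fun x hx => ?_⟩
  have hy : supp y ⊆ y.weights.support := (supp_eq y).le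
  rw [cdfDist_eq_sum hu hw (n := n)]
  · exact sum_congr rfl fun i _ => by rw [cdf_eq_sum_of_supp_subset hx]
  · intro a ha
    obtain ⟨i, -, h⟩ := hmem a (mem_union_left _ (hx ha))
    exact ⟨i, h⟩
  · intro a ha
    obtain ⟨i, -, h⟩ := hmem a (mem_union_right _ (hy ha))
    exact ⟨i, h⟩
  · exact fun i hi => hlt i (mem_union_left _ (hx hi))
  · exact fun i hi => hlt i (mem_union_right _ (hy hi))

/-- `continuous_of_forall_simplex` tests functions of one lottery only. Joint continuity comes from
continuity in one variable and |d(x',y') - d(x,y)| ≤ d(x',x) + d(y',y). -/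
theorem continuous_cdfDist (hu : StrictMono u) :
    Continuous fun p : Lottery × Lottery => cdfDist u p.1 p.2 := by
  rw [continuous_iff_continuousAt]
  rintro ⟨x, y⟩
  rw [ContinuousAt, tendsto_iff_dist_tendsto_zero]
  have h : Filter.Tendsto (fun p : Lottery × Lottery => cdfDist u p.1 x + cdfDist u p.2 y)
      (nhds (x, y)) (nhds 0) := by
    have hc : Continuous fun p : Lottery × Lottery => cdfDist u p.1 x + cdfDist u p.2 y :=
      ((continuous_cdfDist_left hu x).comp continuous_fst).add
        ((continuous_cdfDist_left hu y).comp continuous_snd)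
    simpa [cdfDist_self] using hc.tendsto (x, y)
  refine squeeze_zero (fun _ => dist_nonneg) (fun p => ?_) h
  rw [Real.dist_eq, abs_le]
  have h1 := cdfDist_triangle hu p.1 x p.2
  have h2 := cdfDist_triangle hu x y p.2
  have h3 := cdfDist_triangle hu x p.1 y
  have h4 := cdfDist_triangle hu p.1 p.2 y
  rw [cdfDist_comm u y p.2] at h2
  rw [cdfDist_comm u x p.1] at h3
  constructor <;> linarith

/-! ### Properties of the ratio -/

theorem mix_weights (t : ℝ) (ht : t ∈ Set.Ioo (0 : ℝ) 1) (x z : Lottery) :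
    (mix t ht x z).weights = t • x.weights + (1 - t) • z.weights :=
  Convexity.StdSimplex.weights_convexCombPair ..

theorem mix_sub_mix (t : ℝ) (ht : t ∈ Set.Ioo (0 : ℝ) 1) (x y z : Lottery) :
    (mix t ht x z).weights - (mix t ht y z).weights = t • (x.weights - y.weights) := by
  rw [mix_weights, mix_weights, smul_sub]; abel

theorem ne_of_weights_sub {x y : Lottery} (h : x.weights - y.weights ≠ 0) :
    x ≠ y := by
  rintro rfl; exact h (sub_self _)

theorem weights_sub_ne_zero {x y : Lottery} (h : x ≠ y) :
    x.weights - y.weights ≠ 0 :=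
  fun h0 => h (Convexity.StdSimplex.weights_inj.1 (sub_eq_zero.1 h0))

theorem mix_ne_mix (t : ℝ) (ht : t ∈ Set.Ioo (0 : ℝ) 1) {x y : Lottery}
    (z : Lottery) (h : x ≠ y) : mix t ht x z ≠ mix t ht y z := by
  refine ne_of_weights_sub ?_
  rw [mix_sub_mix]
  exact smul_ne_zero ht.1.ne' (weights_sub_ne_zero h)

theorem ratio_eq_of_sub_eq_smul (hu : StrictMono u) {x y x' y' : Lottery}
    {c : ℝ} (hc : 0 < c) (h : x'.weights - y'.weights = c • (x.weights - y.weights)) :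
    ratio u x' y' = ratio u x y := by
  classical
  obtain ⟨w, hw, hs⟩ := exists_strictMono_supp_subset {x, y, x', y'}
  have hx := hs x (by simp)
  have hy := hs y (by simp)
  have hx' := hs x' (by simp)
  have hy' := hs y' (by simp)
  obtain ⟨f, hf⟩ := exists_shift_eq_sub hu hw hx hy
  have hf' : shift u w (c • f) = x'.weights - y'.weights := by rw [map_smul, hf, h]
  rw [ratio_eq hu hw hx' hy' hf', ratio_eq hu hw hx hy hf, map_smul, oneNorm_smul, smul_eq_mul,
    abs_of_pos hc, mul_div_mul_left _ _ hc.ne']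

/-- Numerators add and denominators are subadditive, so the ratio of the sum is at least a weighted
average of the two ratios; both weights are positive, whence strictness when they differ. -/
theorem min_ratio_le_ratio (hu : StrictMono u) {x y z : Lottery} (hxy : x ≠ y) (hyz : y ≠ z)
    (hxz : x ≠ z) (h1 : 0 ≤ ratio u x y) (h2 : 0 ≤ ratio u y z) :
    min (ratio u x y) (ratio u y z) ≤ ratio u x z ∧
      (ratio u x y ≠ ratio u y z → min (ratio u x y) (ratio u y z) < ratio u x z) := by
  have d1 := cdfDist_pos hu hxy
  have d2 := cdfDist_pos hu hyz
  have d3 := cdfDist_pos hu hxz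
  have ht := cdfDist_triangle hu x y z
  have e1 : ratio u x y * cdfDist u x y = _ := div_mul_cancel₀ _ d1.ne'
  have e2 : ratio u y z * cdfDist u y z = _ := div_mul_cancel₀ _ d2.ne'
  rw [ratio.eq_def u x z, le_div_iff₀ d3, lt_div_iff₀ d3]
  set r1 := ratio u x y
  set r2 := ratio u y z
  have hm : min r1 r2 * cdfDist u x z ≤ min r1 r2 * (cdfDist u x y + cdfDist u y z) :=
    mul_le_mul_of_nonneg_left ht (le_min h1 h2)
  have m1 := mul_le_mul_of_nonneg_right (min_le_left r1 r2) d1.le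
  have m2 := mul_le_mul_of_nonneg_right (min_le_right r1 r2) d2.le
  refine ⟨by linarith, fun hne => ?_⟩
  rcases lt_or_gt_of_ne hne with hlt | hlt
  · have := mul_lt_mul_of_pos_right ((min_le_left r1 r2).trans_lt hlt) d2
    linarith
  · have := mul_lt_mul_of_pos_right ((min_le_right r1 r2).trans_lt hlt) d1
    linarith

/-- Conservation of mass forces the one other altered coordinate to absorb exactly `f k`; its
absolute value grows by at most the |f k| lost at `k`. -/
theorem oneNorm_le_of_move {f g : ℕ →₀ ℝ} {k : ℕ} (hm : mass f = mass g)
    (hk : g k = 0) (hs : {i | i ≠ k ∧ g i ≠ f i}.Subsingleton) : oneNorm g ≤ oneNorm f := by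
  classical
  have hf : oneNorm f = oneNorm (f.erase k) + |f k| := by
    conv_lhs => rw [← f.erase_add_single k]
    exact oneNorm_add_single Finsupp.erase_same _
  by_cases hl : ∃ l, l ≠ k ∧ g l ≠ f l
  · obtain ⟨l, hlk, hl⟩ := hl
    have hg : g = f.erase k + Finsupp.single l (g l - f l) := by
      ext i
      by_cases hil : i = l
      · subst hil; simp [Finsupp.erase_ne hlk]
      · by_cases hik : i = k
        · subst hik; simp [hk, Finsupp.single_eq_of_ne hil]
        · have : g i = f i := by
            by_contra hne
            exact hil (hs ⟨hik, hne⟩ ⟨hlk, hl⟩)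
          simp [Finsupp.erase_ne hik, this, Finsupp.single_eq_of_ne hil]
    have hc : g l - f l = f k := by
      have h1 := congrArg mass hg
      have h2 := congrArg mass (f.erase_add_single k)
      rw [map_add, mass_single] at h1 h2
      linarith
    rw [hc] at hg
    rw [hf, hg]
    refine (oneNorm_add_le _ _).trans ?_
    rw [oneNorm_single]
  · have hg : g = f.erase k := by
      ext i
      by_cases hik : i = k
      · subst hik; simp [hk]
      · rw [Finsupp.erase_ne hik]
        by_contra hne
        exact hl ⟨i, hik, hne⟩
    rw [hf, hg]
    exact le_add_of_nonneg_right (abs_nonneg _)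

/-! ### The axioms hold for a represented choice rule -/

namespace IsCDFRepresentation

theorem eq_ratio (h : IsCDFRepresentation ρ G u) {x y : Lottery} (hxy : x ≠ y) :
    ρ x y = G (ratio u x y) := h.eq x y hxy

theorem le_iff (h : IsCDFRepresentation ρ G u) {x y x' y' : Lottery} (hxy : x ≠ y)
    (hxy' : x' ≠ y') : ρ x y ≤ ρ x' y' ↔ ratio u x y ≤ ratio u x' y' := by
  rw [h.eq_ratio hxy, h.eq_ratio hxy']
  exact h.strictMonoOn.le_iff_le (ratio_mem_Icc h.1 hxy) (ratio_mem_Icc h.1 hxy')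

theorem lt_iff (h : IsCDFRepresentation ρ G u) {x y x' y' : Lottery} (hxy : x ≠ y)
    (hxy' : x' ≠ y') : ρ x y < ρ x' y' ↔ ratio u x y < ratio u x' y' :=
  lt_iff_lt_of_le_iff_le (h.le_iff hxy' hxy)

theorem eq_iff (h : IsCDFRepresentation ρ G u) {x y x' y' : Lottery} (hxy : x ≠ y)
    (hxy' : x' ≠ y') : ρ x y = ρ x' y' ↔ ratio u x y = ratio u x' y' := by
  rw [le_antisymm_iff, le_antisymm_iff, h.le_iff hxy hxy', h.le_iff hxy' hxy]

/-- That G(0) = 1/2 need not be known: ρ(x,y) ≥ 1/2 means ρ(x,y) ≥ ρ(y,x), and swapping the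
lotteries negates the ratio. -/
theorem half_le_iff (hρ : IsBinaryChoiceRule ρ) (h : IsCDFRepresentation ρ G u) {x y : Lottery}
    (hxy : x ≠ y) : 1 / 2 ≤ ρ x y ↔ expectedUtility u y ≤ expectedUtility u x := by
  have h1 := (hρ x y hxy).2
  have h2 := h.le_iff hxy.symm hxy
  rw [ratio_swap] at h2
  have h3 : 1 / 2 ≤ ρ x y ↔ ρ y x ≤ ρ x y := by constructor <;> intro <;> linarith
  rw [h3, h2, neg_le_self_iff, ratio, le_div_iff₀ (cdfDist_pos h.1 hxy), zero_mul, sub_nonneg]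

theorem eq_half_iff (hρ : IsBinaryChoiceRule ρ) (h : IsCDFRepresentation ρ G u) {x y : Lottery}
    (hxy : x ≠ y) : ρ x y = 1 / 2 ↔ expectedUtility u x = expectedUtility u y := by
  have h1 := (hρ x y hxy).2
  have h2 := h.half_le_iff hρ hxy
  have h3 := h.half_le_iff hρ hxy.symm
  rw [le_antisymm_iff, le_antisymm_iff, ← h2, ← h3]
  refine and_congr_left fun _ => ?_
  constructor <;> intro <;> linarith

theorem continuity (h : IsCDFRepresentation ρ G u) : Continuity ρ := by
  have hr : ContinuousOn (fun p : Lottery × Lottery => ratio u p.1 p.2) {p | p.1 ≠ p.2} := by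
    refine ContinuousOn.div ?_ (continuous_cdfDist h.1).continuousOn
      fun p hp => (cdfDist_pos h.1 hp).ne'
    exact (((continuous_expectedUtility u).comp continuous_fst).sub
      ((continuous_expectedUtility u).comp continuous_snd)).continuousOn
  exact (h.continuousOn.comp hr fun p hp => ratio_mem_Icc h.1 hp).congr
    fun p hp => h.eq_ratio hp

theorem independence (h : IsCDFRepresentation ρ G u) : Independence ρ := by
  intro x y z t ht hxy
  rw [h.eq_iff hxy (mix_ne_mix t ht z hxy)]
  exact (ratio_eq_of_sub_eq_smul h.1 ht.1 (mix_sub_mix t ht x y z)).symm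

theorem ratio_nonneg (hρ : IsBinaryChoiceRule ρ) (h : IsCDFRepresentation ρ G u) {x y : Lottery}
    (hxy : x ≠ y) (h1 : 1 / 2 ≤ ρ x y) : 0 ≤ ratio u x y :=
  div_nonneg (sub_nonneg.2 ((h.half_le_iff hρ hxy).1 h1)) (cdfDist_pos h.1 hxy).le

theorem moderateTransitivity (hρ : IsBinaryChoiceRule ρ) (h : IsCDFRepresentation ρ G u) :
    ModerateTransitivity ρ := by
  intro x y z hxy hyz hxz h1 h2
  obtain ⟨hle, hlt⟩ := min_ratio_le_ratio h.1 hxy hyz hxz (h.ratio_nonneg hρ hxy h1)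
    (h.ratio_nonneg hρ hyz h2)
  rw [min_lt_iff, h.lt_iff hxy hxz, h.lt_iff hyz hxz, h.eq_iff hxz hxy, h.eq_iff hxy hyz,
    ← min_lt_iff]
  by_cases he : ratio u x y = ratio u y z
  · rcases hle.lt_or_eq with h' | h'
    · exact Or.inl h'
    · rw [← he, min_self] at h'
      exact Or.inr ⟨h'.symm, he⟩
  · exact Or.inl (hlt he)

theorem dominance (h : IsCDFRepresentation ρ G u) : Dominance ρ := by
  intro x y hxy hd w z hwz
  rw [h.le_iff hwz hxy, h.lt_iff hwz hxy, (ratio_eq_one_iff h.1 hxy).2 hd]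
  have hle := (ratio_mem_Icc h.1 hwz).2
  exact ⟨hle, fun hn => lt_of_le_of_ne hle fun he => hn ((ratio_eq_one_iff h.1 hwz).1 he)⟩

theorem simplification (hρ : IsBinaryChoiceRule ρ) (h : IsCDFRepresentation ρ G u) :
    Simplification ρ := by
  classical
  rintro x y hxy h1 x' hx' ⟨w₀, hw₀, hcdf, hsub⟩ hne hne' hhalf
  have hEU := (h.eq_half_iff hρ hne).1 hhalf
  have hU := (h.half_le_iff hρ hxy).1 h1
  rw [h.le_iff hxy hne', ratio, ratio, hEU]
  refine div_le_div_of_nonneg_left (sub_nonneg.2 hU) (cdfDist_pos h.1 hne') ?_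
  obtain ⟨w, n, hw, hS⟩ := exists_strictMono_cover (x.weights.support ∪ y.weights.support)
  have hS' : supp x ∪ supp y = w '' Set.Iio n := by
    rw [supp_eq, supp_eq, ← coe_union, hS]; simp
  have hrange : supp x ∪ supp y ⊆ Set.range w := by
    rw [hS']; exact Set.image_subset_range _ _
  have hxr := Set.subset_union_left.trans hrange
  have hyr := Set.subset_union_right.trans hrange
  have hxr' := hx'.trans hrange
  obtain ⟨f, hf⟩ := exists_shift_eq_sub h.1 hw hxr hyr
  obtain ⟨g, hg⟩ := exists_shift_eq_sub h.1 hw hxr' hyr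
  rw [cdfDist_eq_oneNorm h.1 hw hxr' hyr hg, cdfDist_eq_oneNorm h.1 hw hxr hyr hf]
  have hfi : ∀ i, f i = -(cdf x (w i) - cdf y (w i)) * gap u w i := fun i => by
    rw [apply_eq_cum_shift h.1 hw f i, hf, map_sub, cdf_eq_cum, cdf_eq_cum]
  have hgi : ∀ i, g i = -(cdf x' (w i) - cdf y (w i)) * gap u w i := fun i => by
    rw [apply_eq_cum_shift h.1 hw g i, hg, map_sub, cdf_eq_cum, cdf_eq_cum]
  rw [hS'] at hw₀
  obtain ⟨k, hk, rfl⟩ := hw₀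
  refine oneNorm_le_of_move (k := k) ?_ ?_ ?_
  · rw [← expectedUtility_sub h.1 hw hf, ← expectedUtility_sub h.1 hw hg, hEU]
  · rw [hgi, hcdf]; simp
  · have hmem : ∀ i, i ≠ k ∧ g i ≠ f i →
        w i ∈ {z ∈ (supp x ∪ supp y) \ {w k} | cdf x' z ≠ cdf x z} := by
      rintro i ⟨hik, hi⟩
      have hc : cdf x' (w i) ≠ cdf x (w i) := fun he => hi (by rw [hgi, hfi, he])
      refine ⟨⟨?_, fun he => hik (hw.injective he)⟩, hc⟩
      rw [hS']
      refine ⟨i, ?_, rfl⟩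
      -- Past index `n` the point `w i` is above both supports, where `cdf x'` and `cdf x` are both
      -- 1.
      by_contra hin
      have hle : ∀ a ∈ supp x ∪ supp y, a ≤ w i := by
        rw [hS']
        rintro _ ⟨j, hj, rfl⟩
        exact hw.monotone (le_of_lt (lt_of_lt_of_le hj (not_lt.1 hin)))
      exact hc (by rw [cdf_eq_one fun a ha => hle a (hx' ha),
        cdf_eq_one fun a ha => hle a (Or.inl ha)])
    exact fun i hi j hj => hw.injective (hsub (hmem i hi) (hmem j hj))

end IsCDFRepresentation

end

section

open Finset

variable {ρ : Lottery → Lottery → ℝ} {G u : ℝ → ℝ}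

/-! ### Lotteries with prescribed differences -/

theorem exists_lottery_support_eq {S : Finset ℝ} (hS : S.Nonempty) :
    ∃ x : Lottery, x.weights.support = S := by
  classical
  have hc : (0 : ℝ) < #S := by exact_mod_cast hS.card_pos
  set p : ℝ →₀ ℝ := Finsupp.indicator S fun _ _ => (1 / #S : ℝ) with hp
  have hpa : ∀ a, p a = if a ∈ S then (1 / #S : ℝ) else 0 := fun a => by
    rw [hp, Finsupp.indicator_apply]; split_ifs <;> rfl
  have hsupp : p.support = S := by
    ext a
    rw [Finsupp.mem_support_iff, hpa]
    by_cases ha : a ∈ S <;> simp [ha, hc.ne']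
  refine ⟨⟨p, fun a => ?_, ?_⟩, hsupp⟩
  · rw [hpa]; split_ifs
    · simp
    · simp
  · rw [Finsupp.sum, hsupp, sum_congr rfl fun a ha => by rw [hpa, if_pos ha]]
    rw [sum_const, nsmul_eq_mul]
    field_simp

theorem exists_lottery_eq_add_smul (x : Lottery) {v : ℝ →₀ ℝ}
    (hv : v.support ⊆ x.weights.support) (hm : mass v = 0) :
    ∃ ε₀ > (0 : ℝ), ∀ ε : ℝ, 0 ≤ ε → ε ≤ ε₀ → ∃ y : Lottery, y.weights = x.weights + ε • v ∧
      y.weights.support = x.weights.support := by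
  obtain ⟨a₀, ha₀, hmin⟩ := x.weights.support.exists_min_image (fun a => x.weights a)
    x.support_weights_nonempty
  have hpos : 0 < x.weights a₀ :=
    lt_of_le_of_ne (weights_nonneg x a₀) (Ne.symm (Finsupp.mem_support_iff.1 ha₀))
  set m := x.weights a₀
  set M := ∑ a ∈ x.weights.support, |v a|
  have hM : 0 ≤ M := sum_nonneg fun _ _ => abs_nonneg _
  -- For 0 < ε ≤ m / (M + 1) one has ε |v a| < m, so no weight in the support vanishes; the + 1
  -- covers v = 0.
  refine ⟨m / (M + 1), by positivity, fun ε h0 hε => ?_⟩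
  rw [le_div_iff₀ (by positivity)] at hε
  have key : ∀ a ∈ x.weights.support, 0 < x.weights a + ε * v a := fun a ha => by
    have h1 : |v a| ≤ M := single_le_sum (f := fun a => |v a|) (fun _ _ => abs_nonneg _) ha
    have h2 := hmin a ha
    have h3 : ε * -v a ≤ ε * M := mul_le_mul_of_nonneg_left ((neg_le_abs _).trans h1) h0
    rcases h0.eq_or_lt with rfl | h0
    · simpa using hpos.trans_le h2
    · linarith
  have hz : ∀ a ∉ x.weights.support, x.weights a + ε * v a = 0 := fun a ha => by
    rw [Finsupp.notMem_support_iff.1 ha, Finsupp.notMem_support_iff.1 fun h => ha (hv h)]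
    simp
  refine ⟨⟨x.weights + ε • v, fun a => ?_, ?_⟩, rfl, ?_⟩
  · by_cases ha : a ∈ x.weights.support
    · simpa using (key a ha).le
    · simpa using (hz a ha).ge
  · rw [← mass_eq_sum, map_add, map_smul, hm, mass_weights]; simp
  · ext a
    by_cases ha : a ∈ x.weights.support
    · simp only [ha, iff_true, Finsupp.mem_support_iff]
      simpa using (key a ha).ne'
    · simp only [ha, iff_false, Finsupp.notMem_support_iff]
      simpa using hz a ha

/-- Both perturbations start from one base lottery and keep its full support `S`. The common base
serves Transitivity, the common support Simplification. -/
theorem exists_lotteries {S : Finset ℝ} (hS : S.Nonempty) {v₁ v₂ : ℝ →₀ ℝ}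
    (h₁ : v₁.support ⊆ S) (h₂ : v₂.support ⊆ S) (m₁ : mass v₁ = 0) (m₂ : mass v₂ = 0) :
    ∃ (ε : ℝ) (x x₁ x₂ : Lottery), 0 < ε ∧ supp x = S ∧ supp x₁ = S ∧ supp x₂ = S ∧
      x₁.weights = x.weights + ε • v₁ ∧ x₂.weights = x.weights + ε • v₂ := by
  obtain ⟨x, rfl⟩ := exists_lottery_support_eq hS
  obtain ⟨ε₁, hε₁, H₁⟩ := exists_lottery_eq_add_smul x h₁ m₁
  obtain ⟨ε₂, hε₂, H₂⟩ := exists_lottery_eq_add_smul x h₂ m₂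
  have hε := lt_min hε₁ hε₂
  obtain ⟨x₁, e₁, s₁⟩ := H₁ _ hε.le (min_le_left _ _)
  obtain ⟨x₂, e₂, s₂⟩ := H₂ _ hε.le (min_le_right _ _)
  exact ⟨_, x, x₁, x₂, hε, supp_eq x, by rw [supp_eq, s₁], by rw [supp_eq, s₂], e₁, e₂⟩

theorem exists_sub_eq_smul {v : ℝ →₀ ℝ} (hm : mass v = 0) :
    ∃ (ε : ℝ) (x y : Lottery), 0 < ε ∧ x.weights - y.weights = ε • v := by
  classical
  obtain ⟨ε, x, x₁, -, hε, -, -, -, h, -⟩ := exists_lotteries (insert_nonempty 0 v.support)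
    (subset_insert 0 v.support) (subset_insert 0 v.support) hm hm
  exact ⟨ε, x₁, x, hε, by rw [h, add_sub_cancel_left]⟩

/-- Coordinates with prescribed mass `r` and norm `1`. -/
noncomputable def unitCoord (r : ℝ) : ℕ →₀ ℝ :=
  Finsupp.single 0 ((1 + r) / 2) - Finsupp.single 1 ((1 - r) / 2)

theorem mass_unitCoord (r : ℝ) : mass (unitCoord r) = r := by
  rw [unitCoord, map_sub, mass_single, mass_single]; ring

theorem oneNorm_unitCoord {r : ℝ} (hr : r ∈ Set.Icc (-1 : ℝ) 1) : oneNorm (unitCoord r) = 1 := by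
  rw [unitCoord, sub_eq_add_neg, ← Finsupp.single_neg, oneNorm_add_single (by simp),
    oneNorm_single, abs_neg, abs_of_nonneg (by linarith [hr.1]), abs_of_nonneg (by linarith [hr.2])]
  ring

theorem unitCoord_ne_zero {r : ℝ} (hr : r ∈ Set.Icc (-1 : ℝ) 1) : unitCoord r ≠ 0 := by
  intro h
  have h1 := oneNorm_unitCoord hr
  rw [h] at h1
  simp [oneNorm] at h1

theorem exists_ratio_eq {w : ℕ → ℝ} (hu : StrictMono u) (hw : StrictMono w) {r : ℝ} (hr : r ∈ Set.Icc (-1 : ℝ) 1) :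
    ∃ (x y : Lottery) (ε : ℝ), x ≠ y ∧ 0 < ε ∧
      x.weights - y.weights = ε • shift u w (unitCoord r) ∧ ratio u x y = r := by
  classical
  set v := shift u w (unitCoord r)
  obtain ⟨ε, y, x, -, hε, sy, sx, -, h, -⟩ := exists_lotteries (S := insert (w 0) v.support)
    (insert_nonempty _ _) (subset_insert _ _) (subset_insert _ _) (mass_shift (unitCoord r))
    (mass_shift (unitCoord r))
  have hS : ↑(insert (w 0) v.support) ⊆ Set.range w := by
    rw [coe_insert]
    exact Set.insert_subset (Set.mem_range_self _) (support_shift_subset _)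
  have hf : shift u w (ε • unitCoord r) = x.weights - y.weights := by
    rw [h, add_sub_cancel_left, map_smul]
  have hratio : ratio u x y = r := by
    rw [ratio_eq hu hw (sx ▸ hS) (sy ▸ hS) hf, oneNorm_smul, map_smul, mass_unitCoord,
      oneNorm_unitCoord hr, abs_of_pos hε, smul_eq_mul]
    field_simp
  refine ⟨x, y, ε, ?_, hε, by rw [h, add_sub_cancel_left], hratio⟩
  rintro rfl
  rw [sub_self] at hf
  have h0 := shift_injective hu hw (hf.trans (map_zero _).symm)
  exact unitCoord_ne_zero hr ((smul_eq_zero.1 h0).resolve_left hε.ne')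

theorem ratio_affine {u' : ℝ → ℝ} {C b : ℝ} (hC : 0 < C) (h : ∀ w, u' w = C * u w + b)
    (x y : Lottery) : ratio u' x y = ratio u x y := by
  have hE : ∀ z : Lottery, expectedUtility u' z = C * expectedUtility u z + b := fun z => by
    have := mass_weights z
    rw [mass_eq_sum, Finsupp.sum] at this
    simp only [expectedUtility, h, add_mul, sum_add_distrib, ← mul_sum, this, mul_one, mul_assoc]
  have hd : cdfDist u' x y = C * cdfDist u x y := by
    simp only [cdfDist, h, add_sub_add_right_eq_sub, ← mul_sub, abs_mul, abs_of_pos hC,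
      intervalIntegral.integral_const_mul]
  rw [ratio, ratio, hE, hE, hd, add_sub_add_right_eq_sub, ← mul_sub, mul_div_mul_left _ _ hC.ne']

/-! ### Uniqueness -/

namespace IsCDFRepresentation

variable {G' u' : ℝ → ℝ}

theorem linearCombination_eq_zero (hρ : IsBinaryChoiceRule ρ) (h : IsCDFRepresentation ρ G u)
    (h' : IsCDFRepresentation ρ G' u') {v : ℝ →₀ ℝ} (hm : mass v = 0)
    (hv : Finsupp.linearCombination ℝ u v = 0) : Finsupp.linearCombination ℝ u' v = 0 := by
  obtain ⟨ε, x, y, hε, hxy⟩ := exists_sub_eq_smul hm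
  have key : ∀ u : ℝ → ℝ, expectedUtility u x = expectedUtility u y ↔
      Finsupp.linearCombination ℝ u v = 0 := fun u => by
    rw [expectedUtility_eq, expectedUtility_eq, ← sub_eq_zero, ← map_sub, hxy, map_smul,
      smul_eq_zero, or_iff_right hε.ne']
  by_cases hne : x = y
  · exact (key u').1 (by rw [hne])
  · rw [← key, ← h'.eq_half_iff hρ hne, h.eq_half_iff hρ hne, key]
    exact hv

theorem utility_unique (hρ : IsBinaryChoiceRule ρ) (h : IsCDFRepresentation ρ G u)
    (h' : IsCDFRepresentation ρ G' u') : ∃ C b : ℝ, 0 < C ∧ ∀ w, u' w = C * u w + b := by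
  have hd : 0 < u 1 - u 0 := sub_pos.2 (h.1 one_pos)
  have hd' : 0 < u' 1 - u' 0 := sub_pos.2 (h'.1 one_pos)
  refine ⟨(u' 1 - u' 0) / (u 1 - u 0), u' 0 - (u' 1 - u' 0) / (u 1 - u 0) * u 0, by positivity,
    fun w => ?_⟩
  -- The vector is δ_w - δ_0 corrected by the multiple of δ_1 - δ_0 that makes its `u`-value zero.
  have key := linearCombination_eq_zero hρ h h'
    (v := (Finsupp.single w 1 - Finsupp.single 0 1) -
      ((u w - u 0) / (u 1 - u 0)) • (Finsupp.single 1 1 - Finsupp.single 0 1))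
    (by simp) (by simp [hd.ne'])
  simp only [map_sub, map_smul, Finsupp.linearCombination_single, smul_eq_mul] at key
  field_simp at key ⊢
  linarith

theorem unique (hρ : IsBinaryChoiceRule ρ) (h : IsCDFRepresentation ρ G u)
    (h' : IsCDFRepresentation ρ G' u') : Set.EqOn G' G (Set.Icc (-1) 1) ∧
      ∃ C b : ℝ, 0 < C ∧ ∀ w, u' w = C * u w + b := by
  have hu := utility_unique hρ h h'
  refine ⟨fun r hr => ?_, hu⟩
  obtain ⟨C, b, hC, he⟩ := hu
  obtain ⟨x, y, -, hxy, -, -, rfl⟩ := exists_ratio_eq h.1 Nat.strictMono_cast hr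
  rw [← h.eq_ratio hxy, ← ratio_affine hC he x y, h'.eq_ratio hxy]

end IsCDFRepresentation

end

section

open Finset

/-! ### Functions of coordinates invariant under moves -/

/-- A function of coordinates that is homogeneous of degree `0`, quasiconcave on its upper half,
and does not decrease when one coordinate is moved onto another. -/
structure IsMoveMonotone (γ : (ℕ →₀ ℝ) → ℝ) : Prop where
  min_le_add : ∀ f h, 0 ≤ mass f → 0 ≤ mass h → min (γ f) (γ h) ≤ γ (f + h)
  smul : ∀ (c : ℝ) (f), 0 < c → γ (c • f) = γ f
  le_move : ∀ (f : ℕ →₀ ℝ) (i j : ℕ), 0 ≤ mass f → i ≠ j →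
    γ f ≤ γ (f - Finsupp.single j (f j) + Finsupp.single i (f j))

namespace IsMoveMonotone

variable {γ : (ℕ →₀ ℝ) → ℝ} {i j : ℕ} {r : ℕ →₀ ℝ}

theorem move_le (H : IsMoveMonotone γ) (hij : i ≠ j) (hj : r j = 0) {c : ℝ} (hm : 0 ≤ mass r + c) :
    γ (r + Finsupp.single j c) ≤ γ (r + Finsupp.single i c) := by
  have := H.le_move (r + Finsupp.single j c) i j (by simpa using hm) hij
  simpa [hj] using this

/-- A move between two empty coordinates can be undone by the opposite move. -/
theorem move_eq (H : IsMoveMonotone γ) (hij : i ≠ j) (hi : r i = 0) (hj : r j = 0) {c : ℝ}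
    (hm : 0 ≤ mass r + c) : γ (r + Finsupp.single j c) = γ (r + Finsupp.single i c) :=
  le_antisymm (H.move_le hij hj hm) (H.move_le hij.symm hi hm)

/-- One inequality is a move. For the other, the split vector is a convex combination of the two
vectors carrying a + b wholly at `i` or wholly at `j`; these have equal value, so quasiconcavity
applies. -/
theorem merge_eq (H : IsMoveMonotone γ) (hij : i ≠ j) (hi : r i = 0) (hj : r j = 0) {a b : ℝ}
    (hab : 0 ≤ a * b) (hm : 0 ≤ mass r + (a + b)) :
    γ (r + Finsupp.single i a + Finsupp.single j b) = γ (r + Finsupp.single i (a + b)) := by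
  apply le_antisymm
  · have := H.move_le (r := r + Finsupp.single i a) (c := b) hij (by simp [hj, hij.symm])
      (by simpa [add_assoc] using hm)
    rwa [add_assoc r (Finsupp.single i a) (Finsupp.single i b), ← Finsupp.single_add] at this
  · rcases eq_or_ne b 0 with rfl | hb
    · simp
    rcases eq_or_ne a 0 with rfl | ha
    · rw [zero_add] at hm ⊢
      rw [Finsupp.single_zero, add_zero]
      exact (H.move_eq hij hi hj hm).ge
    have hpos : 0 < a * b := lt_of_le_of_ne hab (mul_ne_zero ha hb).symm
    have hs : a + b ≠ 0 := by
      rcases pos_and_pos_or_neg_and_neg_of_mul_pos hpos with h | h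
      · linarith
      · linarith
    have h1 : 0 < a / (a + b) := by
      rcases pos_and_pos_or_neg_and_neg_of_mul_pos hpos with h | h
      · exact div_pos h.1 (by linarith)
      · exact div_pos_of_neg_of_neg h.1 (by linarith)
    have h2 : 0 < b / (a + b) := by
      rcases pos_and_pos_or_neg_and_neg_of_mul_pos hpos with h | h
      · exact div_pos h.2 (by linarith)
      · exact div_pos_of_neg_of_neg h.2 (by linarith)
    have he : r + Finsupp.single i a + Finsupp.single j b =
        (a / (a + b)) • (r + Finsupp.single i (a + b)) +
          (b / (a + b)) • (r + Finsupp.single j (a + b)) := by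
      ext k
      simp only [Finsupp.add_apply, Finsupp.smul_apply, smul_eq_mul, Finsupp.single_apply]
      split_ifs <;> field_simp <;> ring
    have hmi : 0 ≤ mass (r + Finsupp.single i (a + b)) := by simpa using hm
    have hmj : 0 ≤ mass (r + Finsupp.single j (a + b)) := by simpa using hm
    have := H.min_le_add ((a / (a + b)) • (r + Finsupp.single i (a + b)))
      ((b / (a + b)) • (r + Finsupp.single j (a + b)))
      (by rw [map_smul]; exact mul_nonneg h1.le hmi) (by rw [map_smul]; exact mul_nonneg h2.le hmj)
    rwa [H.smul _ _ h1, H.smul _ _ h2, H.move_eq hij hi hj hm, min_self, ← he] at this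

/-- Positive entries merge into `i` and negative ones into `j`; (‖f‖ ± mass f)/2 are the totals of
the two parts. Total mass never changes, so every merge is admissible. -/
theorem collect_eq (H : IsMoveMonotone γ) (hij : i ≠ j) (f : ℕ →₀ ℝ) (hi : f i = 0)
    (hj : f j = 0) {p q : ℝ} (hp : 0 ≤ p) (hq : 0 ≤ q) (hm : 0 ≤ p - q + mass f) :
    γ (Finsupp.single i p + Finsupp.single j (-q) + f) =
      γ (Finsupp.single i (p + (oneNorm f + mass f) / 2) +
        Finsupp.single j (-(q + (oneNorm f - mass f) / 2))) := by
  induction f using Finsupp.induction generalizing p q with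
  | zero => simp [oneNorm]
  | single_add k b f hk hb ih =>
    have hk0 := Finsupp.notMem_support_iff.1 hk
    have hki : k ≠ i := by
      rintro rfl
      exact hb (by simpa [hk0] using hi)
    have hkj : k ≠ j := by
      rintro rfl
      exact hb (by simpa [hk0] using hj)
    have hi' : f i = 0 := by simpa [hki] using hi
    have hj' : f j = 0 := by simpa [hkj] using hj
    rw [map_add, mass_single] at hm ⊢
    rw [add_comm (Finsupp.single k b) f, oneNorm_add_single hk0]
    rcases lt_or_gt_of_ne hb with hneg | hpos
    · have h1 := H.merge_eq (r := Finsupp.single i p + f) (i := j) (j := k) (a := -q) (b := b)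
        hkj.symm (by simp [hj', hij]) (by simp [hk0, hki.symm])
        (mul_nonneg_of_nonpos_of_nonpos (by linarith) hneg.le)
        (by rw [map_add, mass_single]; linarith)
      have h2 := ih hi' hj' (p := p) (q := q - b) hp (by linarith) (by linarith)
      rw [abs_of_neg hneg]
      calc _ = γ (Finsupp.single i p + f + Finsupp.single j (-q) + Finsupp.single k b) := by
            congr 1; abel
        _ = γ (Finsupp.single i p + Finsupp.single j (-(q - b)) + f) := by
            rw [h1, show -q + b = -(q - b) by ring]; congr 1; abel
        _ = _ := by rw [h2]; congr 3 <;> ring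
    · have h1 := H.merge_eq (r := Finsupp.single j (-q) + f) (i := i) (j := k) (a := p) (b := b)
        hki.symm (by simp [hi', hij.symm]) (by simp [hk0, hkj.symm])
        (mul_nonneg hp hpos.le) (by rw [map_add, mass_single]; linarith)
      have h2 := ih hi' hj' (p := p + b) (q := q) (by linarith) hq (by linarith)
      rw [abs_of_pos hpos]
      calc _ = γ (Finsupp.single j (-q) + f + Finsupp.single i p + Finsupp.single k b) := by
            congr 1; abel
        _ = γ (Finsupp.single i (p + b) + Finsupp.single j (-q) + f) := by
            rw [h1]; congr 1; abel
        _ = _ := by rw [h2]; congr 3 <;> ring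

theorem eq_of_mass_eq_of_oneNorm_eq (H : IsMoveMonotone γ) {f g : ℕ →₀ ℝ} (hm : mass f = mass g)
    (hn : oneNorm f = oneNorm g) (h0 : 0 ≤ mass f) : γ f = γ g := by
  obtain ⟨n, hf, hg⟩ := exists_support_subset_range₂ f g
  have key : ∀ h : ℕ →₀ ℝ, h.support ⊆ range n → ∀ k, n ≤ k → h k = 0 := fun h hh k hk =>
    Finsupp.notMem_support_iff.1 fun h' => by have := mem_range.1 (hh h'); omega
  -- The indices n and n + 1 are empty in both `f` and `g`, so both are collected at the same
  -- places.
  have h1 := H.collect_eq (i := n) (j := n + 1) (by omega) f (key f hf _ le_rfl)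
    (key f hf _ (by omega)) le_rfl le_rfl (by simpa using h0)
  have h2 := H.collect_eq (i := n) (j := n + 1) (by omega) g (key g hg _ le_rfl)
    (key g hg _ (by omega)) le_rfl le_rfl (by simpa [← hm] using h0)
  rw [hm, hn, ← h2] at h1
  simpa using h1

theorem eq_of_div_eq (H : IsMoveMonotone γ) {f g : ℕ →₀ ℝ} (hf : f ≠ 0) (hg : g ≠ 0)
    (h : mass f / oneNorm f = mass g / oneNorm g) (h0 : 0 ≤ mass f) : γ f = γ g := by
  have hf' := inv_pos.2 (oneNorm_pos hf)
  have hg' := inv_pos.2 (oneNorm_pos hg)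
  rw [← H.smul _ f hf', ← H.smul _ g hg']
  apply H.eq_of_mass_eq_of_oneNorm_eq
  · rw [map_smul, map_smul, smul_eq_mul, smul_eq_mul, ← div_eq_inv_mul, ← div_eq_inv_mul, h]
  · rw [oneNorm_smul, oneNorm_smul, abs_of_pos hf', abs_of_pos hg',
      inv_mul_cancel₀ (oneNorm_pos hf).ne', inv_mul_cancel₀ (oneNorm_pos hg).ne']
  · rw [map_smul]; exact mul_nonneg hf'.le h0

end IsMoveMonotone

end

section

open Finset

/-- The map stays in a single simplex, whose topology is coordinatewise and whose inclusion is
continuous. -/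
theorem continuous_of_weights {T : Type*} [TopologicalSpace T]
    {ψ : T → Lottery} {S : Finset ℝ} (hS : ∀ t, supp (ψ t) ⊆ S)
    (h : ∀ a, Continuous fun t => (ψ t).weights a) : Continuous ψ := by
  set τ : TopologicalSpace {x : Lottery // supp x ⊆ (S : Set ℝ)} :=
    TopologicalSpace.induced (fun x (w : ℝ) => x.1.weights w) Pi.topologicalSpace
  have h1 : @Continuous _ _ _ τ fun t => (⟨ψ t, hS t⟩ : {x : Lottery // supp x ⊆ (S : Set ℝ)}) :=
    continuous_induced_rng.2 (continuous_pi h)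
  have h2 : @Continuous _ _ τ _ (Subtype.val : {x : Lottery // supp x ⊆ (S : Set ℝ)} → Lottery) :=
    continuous_iff_coinduced_le.2 (le_iSup (fun S : Finset ℝ =>
      TopologicalSpace.coinduced (Subtype.val : {x : Lottery // supp x ⊆ (S : Set ℝ)} → Lottery)
        (TopologicalSpace.induced (fun x (w : ℝ) => x.1.weights w) Pi.topologicalSpace)) S)
  exact @Continuous.comp _ _ _ _ τ _ _ _ h2 h1

/-! ### The choice probability as a function of the difference of lotteries -/

/-- A binary choice rule that satisfies the five axioms. -/
structure Admissible (ρ : Lottery → Lottery → ℝ) : Prop where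
  rule : IsBinaryChoiceRule ρ
  continuity : Continuity ρ
  independence : Independence ρ
  transitivity : ModerateTransitivity ρ
  dominance : Dominance ρ
  simplification : Simplification ρ

open Classical in
/-- The common value of `ρ x y` over the lotteries with `x - y` a positive multiple of `v`. -/
noncomputable def score (ρ : Lottery → Lottery → ℝ) (v : ℝ →₀ ℝ) : ℝ :=
  if h : ∃ (x y : Lottery) (c : ℝ), 0 < c ∧ x ≠ y ∧ x.weights - y.weights = c • v then
    ρ h.choose h.choose_spec.choose else 1 / 2

variable {ρ : Lottery → Lottery → ℝ}

/-- Distinct lotteries have nonzero difference, so the default applies; the value 1/2 places 0 among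
the indifferent directions. -/
theorem score_zero : score ρ 0 = 1 / 2 := by
  rw [score, dif_neg]
  rintro ⟨x, y, c, -, hxy, h⟩
  rw [smul_zero] at h
  exact weights_sub_ne_zero hxy h

namespace Admissible

/-- Since x + y' = x' + y, mixing (x,y) equally with y' and (x',y') equally with y gives the same
pair. -/
theorem rule_eq_of_sub_eq (A : Admissible ρ) {x y x' y' : Lottery} (hxy : x ≠ y)
    (h : x'.weights - y'.weights = x.weights - y.weights) : ρ x' y' = ρ x y := by
  have ht : (1 / 2 : ℝ) ∈ Set.Ioo (0 : ℝ) 1 := by norm_num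
  have hxy' : x' ≠ y' := ne_of_weights_sub (h ▸ weights_sub_ne_zero hxy)
  have e1 : mix _ ht x y' = mix _ ht x' y := by
    rw [← Convexity.StdSimplex.weights_inj, mix_weights, mix_weights]
    norm_num
    rw [← smul_add, ← smul_add, eq_add_of_sub_eq h]
    congr 1; abel
  have e2 : mix _ ht y y' = mix _ ht y' y := by
    rw [← Convexity.StdSimplex.weights_inj, mix_weights, mix_weights]
    norm_num
    rw [add_comm]
  rw [A.independence x y y' _ ht hxy, A.independence x' y' y _ ht hxy', e1, e2]

theorem rule_eq_of_sub_eq_smul (A : Admissible ρ) {x y x' y' : Lottery} {c : ℝ} (hc : 0 < c)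
    (hxy : x ≠ y) (h : x'.weights - y'.weights = c • (x.weights - y.weights)) :
    ρ x' y' = ρ x y := by
  have key : ∀ {c : ℝ} {x y x' y' : Lottery}, 0 < c → c < 1 → x ≠ y →
      x'.weights - y'.weights = c • (x.weights - y.weights) → ρ x' y' = ρ x y := by
    intro c x y x' y' h0 h1 hxy h
    have ht : c ∈ Set.Ioo (0 : ℝ) 1 := ⟨h0, h1⟩
    rw [A.independence x y y c ht hxy]
    refine A.rule_eq_of_sub_eq (mix_ne_mix c ht y hxy) ?_
    rw [h, mix_sub_mix]
  rcases lt_trichotomy c 1 with h1 | rfl | h1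
  · exact key hc h1 hxy h
  · exact A.rule_eq_of_sub_eq hxy (by rw [h, one_smul])
  · refine (key (inv_pos.2 hc) (inv_lt_one_of_one_lt₀ h1) (ne_of_weights_sub ?_) ?_).symm
    · rw [h]; exact smul_ne_zero hc.ne' (weights_sub_ne_zero hxy)
    · rw [h, smul_smul, inv_mul_cancel₀ hc.ne', one_smul]

theorem score_eq (A : Admissible ρ) {x y : Lottery} {v : ℝ →₀ ℝ} {c : ℝ} (hc : 0 < c)
    (hxy : x ≠ y) (h : x.weights - y.weights = c • v) : score ρ v = ρ x y := by
  have hex : ∃ (x y : Lottery) (c : ℝ), 0 < c ∧ x ≠ y ∧ x.weights - y.weights = c • v :=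
    ⟨x, y, c, hc, hxy, h⟩
  rw [score, dif_pos hex]
  obtain ⟨d, hd, -, he⟩ := hex.choose_spec.choose_spec
  refine A.rule_eq_of_sub_eq_smul (c := d * c⁻¹) (mul_pos hd (inv_pos.2 hc)) hxy ?_
  rw [he, h, smul_smul, inv_mul_cancel_right₀ hc.ne']

theorem score_sub (A : Admissible ρ) {x y : Lottery} (hxy : x ≠ y) :
    score ρ (x.weights - y.weights) = ρ x y :=
  A.score_eq one_pos hxy (one_smul _ _).symm

theorem exists_score_eq (A : Admissible ρ) {v : ℝ →₀ ℝ} (hm : mass v = 0) (hv : v ≠ 0) :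
    ∃ (x y : Lottery) (c : ℝ), 0 < c ∧ x ≠ y ∧ x.weights - y.weights = c • v ∧
      score ρ v = ρ x y := by
  obtain ⟨ε, x, y, hε, h⟩ := exists_sub_eq_smul hm
  have hne : x ≠ y := ne_of_weights_sub (by rw [h]; exact smul_ne_zero hε.ne' hv)
  exact ⟨x, y, ε, hε, hne, h, A.score_eq hε hne h⟩

theorem score_smul (A : Admissible ρ) {v : ℝ →₀ ℝ} {c : ℝ} (hm : mass v = 0) (hc : 0 < c) :
    score ρ (c • v) = score ρ v := by
  rcases eq_or_ne v 0 with rfl | hv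
  · rw [smul_zero]
  obtain ⟨x, y, d, hd, hxy, h, e⟩ := A.exists_score_eq hm hv
  rw [e]
  refine A.score_eq (c := d * c⁻¹) (mul_pos hd (inv_pos.2 hc)) hxy ?_
  rw [h, smul_smul, inv_mul_cancel_right₀ hc.ne']

theorem score_neg (A : Admissible ρ) {v : ℝ →₀ ℝ} (hm : mass v = 0) :
    score ρ (-v) = 1 - score ρ v := by
  rcases eq_or_ne v 0 with rfl | hv
  · rw [neg_zero, score_zero]; norm_num
  obtain ⟨x, y, d, hd, hxy, h, e⟩ := A.exists_score_eq hm hv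
  rw [e, ← (A.rule y x hxy.symm).2]
  exact A.score_eq hd hxy.symm (by rw [smul_neg, ← h, neg_sub])

/-- Transitivity is applied to y + εv, y, y - εw. The cases in which these are not distinct are v =
0, w = 0 and v + w = 0, treated first. -/
theorem score_add (A : Admissible ρ) {v w : ℝ →₀ ℝ} (hv : mass v = 0) (hw : mass w = 0)
    (h1 : 1 / 2 ≤ score ρ v) (h2 : 1 / 2 ≤ score ρ w) :
    min (score ρ v) (score ρ w) ≤ score ρ (v + w) ∧
      (score ρ v ≠ score ρ w → min (score ρ v) (score ρ w) < score ρ (v + w)) := by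
  classical
  rcases eq_or_ne v 0 with rfl | hv0
  · rw [zero_add, score_zero] at *
    exact ⟨min_le_right _ _, fun h => min_lt_of_left_lt (lt_of_le_of_ne h2 h)⟩
  rcases eq_or_ne w 0 with rfl | hw0
  · rw [add_zero, score_zero] at *
    exact ⟨min_le_left _ _, fun h => min_lt_of_right_lt (lt_of_le_of_ne h1 h.symm)⟩
  by_cases hvw : v + w = 0
  · have hw' : w = -v := (neg_eq_of_add_eq_zero_right hvw).symm
    have h3 := A.score_neg hv
    rw [← hw'] at h3
    have e1 : score ρ v = 1 / 2 := by linarith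
    have e2 : score ρ w = 1 / 2 := by linarith
    rw [hvw, score_zero, e1, e2]
    simp
  have hnw : mass (-w) = 0 := by rw [map_neg, hw, neg_zero]
  obtain ⟨ε, y, x, z, hε, -, -, -, hx, hz⟩ :=
    exists_lotteries (S := insert 0 (v.support ∪ (-w).support)) (insert_nonempty _ _)
      (subset_union_left.trans (subset_insert _ _)) (subset_union_right.trans (subset_insert _ _))
      hv hnw
  have exy : x.weights - y.weights = ε • v := by rw [hx]; abel
  have eyz : y.weights - z.weights = ε • w := by rw [hz, smul_neg]; abel
  have exz : x.weights - z.weights = ε • (v + w) := by rw [hx, hz, smul_neg, smul_add]; abel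
  have nxy : x ≠ y := ne_of_weights_sub (exy ▸ smul_ne_zero hε.ne' hv0)
  have nyz : y ≠ z := ne_of_weights_sub (eyz ▸ smul_ne_zero hε.ne' hw0)
  have nxz : x ≠ z := ne_of_weights_sub (exz ▸ smul_ne_zero hε.ne' hvw)
  have key := A.transitivity x y z nxy nyz nxz
  rw [← A.score_eq hε nxy exy, ← A.score_eq hε nyz eyz, ← A.score_eq hε nxz exz] at key
  rcases key h1 h2 with h | ⟨h, h'⟩
  · exact ⟨h.le, fun _ => h⟩
  · exact ⟨by rw [h]; exact min_le_left _ _, fun hne => absurd h' hne⟩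

/-- The score along the segment is ρ(ψ t, y) for a segment ψ of lotteries and a fixed `y`;
nonvanishing keeps the pair off the diagonal. -/
theorem continuousOn_score_segment (A : Admissible ρ) {v₀ v₁ : ℝ →₀ ℝ} (h₀ : mass v₀ = 0)
    (h₁ : mass v₁ = 0) (hne : ∀ t ∈ Set.Icc (0 : ℝ) 1, (1 - t) • v₀ + t • v₁ ≠ 0) :
    ContinuousOn (fun t : ℝ => score ρ ((1 - t) • v₀ + t • v₁)) (Set.Icc 0 1) := by
  classical
  obtain ⟨ε, y, x₀, x₁, hε, -, s₀, s₁, e₀, e₁⟩ :=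
    exists_lotteries (S := insert 0 (v₀.support ∪ v₁.support)) (insert_nonempty _ _)
      (subset_union_left.trans (subset_insert _ _)) (subset_union_right.trans (subset_insert _ _))
      h₀ h₁
  set S := insert (0 : ℝ) (v₀.support ∪ v₁.support)
  set ψ : Set.Icc (0 : ℝ) 1 → Lottery := fun t =>
    Convexity.convexCombPair (1 - t.1) t.1 (sub_nonneg.2 t.2.2) t.2.1 (sub_add_cancel _ _) x₀ x₁
  have hψ : ∀ t, (ψ t).weights = (1 - t.1) • x₀.weights + t.1 • x₁.weights := fun t =>
    Convexity.StdSimplex.weights_convexCombPair ..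
  have hc : Continuous ψ := by
    refine continuous_of_weights (S := S) (fun t => ?_) fun a => ?_
    · rw [supp_eq, coe_subset, hψ]
      rw [supp_eq, coe_inj] at s₀ s₁
      refine Finsupp.support_add.trans (union_subset ?_ ?_)
      · exact Finsupp.support_smul.trans s₀.subset
      · exact Finsupp.support_smul.trans s₁.subset
    · simp only [hψ, Finsupp.add_apply, Finsupp.smul_apply, smul_eq_mul]
      fun_prop
  have hsub : ∀ t, (ψ t).weights - y.weights = ε • ((1 - t.1) • v₀ + t.1 • v₁) := fun t => by
    rw [hψ, e₀, e₁]
    module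
  have hψy : ∀ t, ψ t ≠ y := fun t =>
    ne_of_weights_sub (hsub t ▸ smul_ne_zero hε.ne' (hne t.1 t.2))
  rw [continuousOn_iff_continuous_domRestrict]
  have hcomp : Continuous fun t => ρ (ψ t) y :=
    A.continuity.comp_continuous (hc.prodMk continuous_const) hψy
  refine hcomp.congr fun t => ?_
  exact (A.score_eq hε (hψy t) (hsub t)).symm

/-! ### Indifferent directions and the utility -/

/-- The differences of indifferent lotteries. -/
noncomputable def indifferent (A : Admissible ρ) : Submodule ℝ (ℝ →₀ ℝ) where
  carrier := {v | mass v = 0 ∧ score ρ v = 1 / 2}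
  zero_mem' := ⟨map_zero _, score_zero⟩
  add_mem' := by
    rintro v w ⟨hv, ev⟩ ⟨hw, ew⟩
    have hvw : mass (v + w) = 0 := by rw [map_add, hv, hw, add_zero]
    refine ⟨hvw, le_antisymm ?_ ?_⟩
    · have h1 := A.score_neg hv
      have h2 := A.score_neg hw
      have h3 := A.score_neg hvw
      have h4 := (A.score_add (v := -v) (w := -w) (by rw [map_neg, hv, neg_zero])
        (by rw [map_neg, hw, neg_zero]) (by linarith) (by linarith)).1
      rw [← neg_add, h1, h2, h3, ev, ew, min_self] at h4
      linarith
    · have h4 := (A.score_add hv hw ev.ge ew.ge).1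
      rwa [ev, ew, min_self] at h4
  smul_mem' := by
    rintro c v ⟨hv, ev⟩
    refine ⟨by rw [map_smul, hv, smul_zero], ?_⟩
    rcases lt_trichotomy c 0 with h | rfl | h
    · rw [← neg_neg c, neg_smul, ← smul_neg, A.score_smul (by rw [map_neg, hv, neg_zero])
        (neg_pos.2 h), A.score_neg hv, ev]
      norm_num
    · rw [zero_smul, score_zero]
    · rw [A.score_smul hv h, ev]

theorem mem_indifferent (A : Admissible ρ) {v : ℝ →₀ ℝ} :
    v ∈ A.indifferent ↔ mass v = 0 ∧ score ρ v = 1 / 2 := Iff.rfl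

theorem half_lt_score_single (A : Admissible ρ) {a b : ℝ} (hab : a < b) :
    1 / 2 < score ρ (Finsupp.single b 1 - Finsupp.single a 1) := by
  set x : Lottery := Convexity.StdSimplex.single b
  set y : Lottery := Convexity.StdSimplex.single a
  have cx : ∀ z, cdf x z = if b ≤ z then 1 else 0 := fun z => by
    rw [cdf_eq_cum]; exact cum_single z b 1
  have cy : ∀ z, cdf y z = if a ≤ z then 1 else 0 := fun z => by
    rw [cdf_eq_cum]; exact cum_single z a 1
  have hd : FOSD x y := fun z => by
    rw [cx, cy]; split_ifs <;> linarith
  have hd' : ¬ FOSD y x := fun h => by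
    have := h a
    rw [cx, cy, if_pos le_rfl, if_neg (not_le.2 hab)] at this
    linarith
  have hxy : x ≠ y := fun h => hd' (h ▸ hd)
  have h1 := (A.dominance x y hxy hd y x hxy.symm).2 hd'
  have h2 := (A.rule x y hxy).2
  have h3 := A.score_sub hxy
  change score ρ (Finsupp.single b 1 - Finsupp.single a 1) = ρ x y at h3
  rw [h3]
  linarith

/-- The intermediate value theorem runs from `v` to `e` or `-e`, whichever lies on the other side of
1/2. If `v` is a multiple of `e` the segment could meet 0, so that case is separate. -/
theorem exists_sub_smul_mem_indifferent (A : Admissible ρ) {v e : ℝ →₀ ℝ} (hv : mass v = 0)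
    (he : mass e = 0) (hpos : 1 / 2 < score ρ e) : ∃ t : ℝ, v - t • e ∈ A.indifferent := by
  by_cases hspan : ∃ t : ℝ, v = t • e
  · obtain ⟨t, rfl⟩ := hspan
    exact ⟨t, by rw [sub_self]; exact zero_mem _⟩
  have key : ∀ s : ℝ, s ≠ 0 → (1 / 2 : ℝ) ∈ Set.uIcc (score ρ v) (score ρ (s • e)) →
      score ρ (s • e) ≠ 1 / 2 → ∃ t : ℝ, v - t • e ∈ A.indifferent := by
    intro s hs hmem hse
    have hsm : mass (s • e) = 0 := by rw [map_smul, he, smul_zero]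
    have hne : ∀ t ∈ Set.Icc (0 : ℝ) 1, (1 - t) • v + t • (s • e) ≠ 0 := by
      intro t _ h0
      rcases eq_or_ne t 1 with rfl | ht
      · rw [sub_self, zero_smul, zero_add, one_smul] at h0
        have := score_zero (ρ := ρ)
        rw [← h0] at this
        exact hse this
      · have h1 : (1 - t) ≠ 0 := sub_ne_zero.2 ht.symm
        refine hspan ⟨-((1 - t)⁻¹ * (t * s)), ?_⟩
        have h2 := congrArg (fun x => (1 - t)⁻¹ • x) (eq_neg_of_add_eq_zero_left h0)
        simp only [smul_smul, inv_mul_cancel₀ h1, one_smul, smul_neg] at h2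
        rw [h2, neg_smul]
    have hc := A.continuousOn_score_segment hv hsm hne
    rw [← Set.uIcc_of_le zero_le_one] at hc
    obtain ⟨t, -, ht⟩ := intermediate_value_uIcc hc (by simpa using hmem)
    replace ht : score ρ ((1 - t) • v + t • (s • e)) = 1 / 2 := by rw [one_div]; exact ht
    have ht1 : t ≠ 1 := by
      rintro rfl
      rw [sub_self, zero_smul, zero_add, one_smul] at ht
      exact hse ht
    have h1 : (1 - t) ≠ 0 := sub_ne_zero.2 ht1.symm
    have hmem' : (1 - t) • v + t • (s • e) ∈ A.indifferent :=
      A.mem_indifferent.2 ⟨by rw [map_add, map_smul, map_smul, hv, hsm]; simp, ht⟩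
    refine ⟨-((1 - t)⁻¹ * (t * s)), ?_⟩
    have := A.indifferent.smul_mem (1 - t)⁻¹ hmem'
    rwa [smul_add, smul_smul, smul_smul, smul_smul, inv_mul_cancel₀ h1, one_smul, mul_assoc,
      ← sub_neg_eq_add, ← neg_smul] at this
  have hneg := A.score_neg he
  rcases le_total (score ρ v) (1 / 2) with h | h
  · refine key 1 one_ne_zero ?_ ?_
    · rw [one_smul, Set.mem_uIcc]; exact Or.inl ⟨h, hpos.le⟩
    · rw [one_smul]; exact hpos.ne'
  · refine key (-1) (by norm_num) ?_ ?_
    · rw [neg_one_smul, Set.mem_uIcc, hneg]; exact Or.inr ⟨by linarith, h⟩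
    · rw [neg_one_smul, hneg]; linarith

/-- Expected utility represents the preference revealed by the choice rule. -/
theorem exists_utility (A : Admissible ρ) : ∃ u : ℝ → ℝ, StrictMono u ∧
    ∀ v, mass v = 0 → (1 / 2 ≤ score ρ v ↔ 0 ≤ Finsupp.linearCombination ℝ u v) := by
  set e : ℝ →₀ ℝ := Finsupp.single 1 1 - Finsupp.single 0 1
  have he : mass e = 0 := by simp [e]
  have hpos : 1 / 2 < score ρ e := A.half_lt_score_single one_pos
  have hneg := A.score_neg he
  have hex : ∀ a : ℝ, ∃ t : ℝ, (Finsupp.single a 1 - Finsupp.single 0 1) - t • e ∈ A.indifferent :=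
    fun a => A.exists_sub_smul_mem_indifferent (by simp) he hpos
  -- The utility of `a` is the multiple of δ_1 - δ_0 indifferent to δ_a - δ_0.
  choose u hu using hex
  have hmem : ∀ v, mass v = 0 → v - Finsupp.linearCombination ℝ u v • e ∈ A.indifferent := by
    intro v hv
    have h1 : v - Finsupp.linearCombination ℝ u v • e = ∑ a ∈ v.support,
        v a • ((Finsupp.single a 1 - Finsupp.single 0 1) - u a • e) := by
      simp only [smul_sub (v _) _ (u _ • e), sum_sub_distrib, smul_smul, ← sum_smul]
      rw [← eq_sum_single_sub hv 0, Finsupp.linearCombination_apply, Finsupp.sum]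
      rfl
    rw [h1]
    exact Submodule.sum_mem _ fun a _ => A.indifferent.smul_mem _ (hu a)
  have hfwd : ∀ v, mass v = 0 → 0 ≤ Finsupp.linearCombination ℝ u v → 1 / 2 ≤ score ρ v := by
    intro v hv hL
    obtain ⟨m0, hs⟩ := A.mem_indifferent.1 (hmem v hv)
    have h2 : 1 / 2 ≤ score ρ (Finsupp.linearCombination ℝ u v • e) := by
      rcases hL.eq_or_lt with h | h
      · rw [← h, zero_smul, score_zero]
      · rw [A.score_smul he h]; exact hpos.le
    have h3 := (A.score_add m0 (by rw [map_smul, he, smul_zero]) hs.ge h2).1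
    rw [sub_add_cancel] at h3
    exact (le_min hs.ge h2).trans h3
  have hiff : ∀ v, mass v = 0 → (1 / 2 ≤ score ρ v ↔ 0 ≤ Finsupp.linearCombination ℝ u v) := by
    refine fun v hv => ⟨fun h => ?_, hfwd v hv⟩
    by_contra hL
    rw [not_le] at hL
    have hv' : mass (-v) = 0 := by rw [map_neg, hv, neg_zero]
    have h1 := hfwd (-v) hv' (by rw [map_neg]; linarith)
    rw [A.score_neg hv] at h1
    -- If EU(v) < 0 and score v ≥ 1/2, then `v` is indifferent, hence so is EU(v) • e and then `e`
    -- itself, a contradiction.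
    have h2 : v ∈ A.indifferent := A.mem_indifferent.2 ⟨hv, by linarith⟩
    have h3 := A.indifferent.sub_mem h2 (hmem v hv)
    rw [sub_sub_cancel] at h3
    have h4 := (A.indifferent.smul_mem_iff hL.ne).1 h3
    have h5 := (A.mem_indifferent.1 h4).2
    linarith
  refine ⟨u, fun a b hab => ?_, hiff⟩
  have h1 := A.half_lt_score_single hab
  have h2 := A.score_neg (v := Finsupp.single b 1 - Finsupp.single a 1) (by simp)
  have h3 := hiff (-(Finsupp.single b 1 - Finsupp.single a 1)) (by simp)
  by_contra hba
  have h4 := h3.2 (by simpa using not_lt.1 hba)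
  linarith

end Admissible

end

section

open Finset

variable {ρ : Lottery → Lottery → ℝ} {u : ℝ → ℝ} {w : ℕ → ℝ}

/-! ### Construction of the representation -/

namespace Admissible

theorem half_le_score_shift (hu : StrictMono u) (hw : StrictMono w)
    (hL : ∀ v, mass v = 0 → (1 / 2 ≤ score ρ v ↔ 0 ≤ Finsupp.linearCombination ℝ u v))
    (f : ℕ →₀ ℝ) : 1 / 2 ≤ score ρ (shift u w f) ↔ 0 ≤ mass f := by
  rw [hL _ (mass_shift f), linearCombination_shift hu hw]

theorem score_shift_eq_half (A : Admissible ρ) (hu : StrictMono u) (hw : StrictMono w)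
    (hL : ∀ v, mass v = 0 → (1 / 2 ≤ score ρ v ↔ 0 ≤ Finsupp.linearCombination ℝ u v))
    {f : ℕ →₀ ℝ} (hf : mass f = 0) : score ρ (shift u w f) = 1 / 2 := by
  have h1 := (half_le_score_shift hu hw hL f).2 hf.ge
  have h2 := (half_le_score_shift hu hw hL (-f)).2 (by rw [map_neg, hf, neg_zero])
  rw [map_neg, A.score_neg (mass_shift f)] at h2
  linarith

/-- This is Simplification with w* = `w j`: emptying coordinate `j` equates the CDFs of x' and y
there, only coordinate `i` changes besides, and conserved mass makes x' and x indifferent. -/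
theorem score_shift_le_move (A : Admissible ρ) (hu : StrictMono u) (hw : StrictMono w)
    (hL : ∀ v, mass v = 0 → (1 / 2 ≤ score ρ v ↔ 0 ≤ Finsupp.linearCombination ℝ u v))
    (f : ℕ →₀ ℝ) (i j : ℕ) (hf : 0 ≤ mass f) (hij : i ≠ j) :
    score ρ (shift u w f) ≤
      score ρ (shift u w (f - Finsupp.single j (f j) + Finsupp.single i (f j))) := by
  classical
  by_cases hj : f j = 0
  · simp [hj]
  set g := f - Finsupp.single j (f j) + Finsupp.single i (f j) with hg
  have hmg : mass g = mass f := by simp [hg]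
  have hf0 : f ≠ 0 := by rintro rfl; simp at hj
  by_cases hg0 : g = 0
  · rw [A.score_shift_eq_half hu hw hL (f := g) (by rw [hg0, map_zero]),
      A.score_shift_eq_half hu hw hL (f := f) (by rw [← hmg, hg0, map_zero])]
  have hgj : g j = 0 := by simp [hg, hij.symm]
  have hgk : ∀ k, k ≠ i → k ≠ j → g k = f k := fun k hki hkj => by simp [hg, hki, hkj]
  have hgf : g - f ≠ 0 := fun h => hj (by rw [← sub_eq_zero.1 h, hgj])
  -- The axiom needs `w j` in a support, but contributions of adjacent intervals may cancel there;
  -- hence the insertion.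
  set S := insert (w j) ((shift u w f).support ∪ (shift u w g).support) with hS
  have hSw : ↑S ⊆ Set.range w := by
    rw [hS, coe_insert, coe_union]
    exact Set.insert_subset (Set.mem_range_self _)
      (Set.union_subset (support_shift_subset f) (support_shift_subset g))
  obtain ⟨ε, y, x, x', hε, sy, sx, sx', ex, ex'⟩ := exists_lotteries (S := S) (insert_nonempty _ _)
    (subset_union_left.trans (subset_insert _ _)) (subset_union_right.trans (subset_insert _ _))
    (mass_shift f) (mass_shift g)
  have hinj : ∀ h : ℕ →₀ ℝ, h ≠ 0 → ε • shift u w h ≠ 0 := fun h hh =>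
    smul_ne_zero hε.ne' fun h0 => hh (shift_injective hu hw (h0.trans (map_zero _).symm))
  have dxy : x.weights - y.weights = ε • shift u w f := by rw [ex]; abel
  have dxy' : x'.weights - y.weights = ε • shift u w g := by rw [ex']; abel
  have dxx' : x'.weights - x.weights = ε • shift u w (g - f) := by
    rw [ex, ex', map_sub, smul_sub]; abel
  have nxy : x ≠ y := ne_of_weights_sub (dxy ▸ hinj f hf0)
  have nxy' : x' ≠ y := ne_of_weights_sub (dxy' ▸ hinj g hg0)
  have nxx' : x' ≠ x := ne_of_weights_sub (dxx' ▸ hinj _ hgf)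
  rw [A.score_eq hε nxy dxy, A.score_eq hε nxy' dxy']
  refine A.simplification x y nxy ?_ x' ?_ ⟨w j, ?_, ?_, ?_⟩ nxx' nxy' ?_
  · rw [← A.score_eq hε nxy dxy]
    exact (half_le_score_shift hu hw hL f).2 hf
  · rw [sx', sx, sy, Set.union_self]
  · rw [sx, sy, Set.union_self, mem_coe]
    exact mem_insert_self _ _
  · rw [cdf_eq_cum, cdf_eq_cum, ex', map_add, map_smul, cum_shift hw, hgj]
    simp
  · have hsub : {z ∈ (supp x ∪ supp y) \ {w j} | cdf x' z ≠ cdf x z} ⊆ {w i} := by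
      rintro z ⟨⟨hz, hzj⟩, hne⟩
      rw [sx, sy, Set.union_self] at hz
      obtain ⟨k, rfl⟩ := hSw hz
      have hkj : k ≠ j := fun h => hzj (by rw [h]; rfl)
      by_contra hki
      have hki' : k ≠ i := fun h => hki (by rw [h]; rfl)
      apply hne
      have he : cum (w k) (shift u w g) = cum (w k) (shift u w f) := by
        rw [cum_shift hw, cum_shift hw, hgk k hki' hkj]
      rw [cdf_eq_cum, cdf_eq_cum, ex, ex', map_add (cum _) _ (ε • shift u w f),
        map_add (cum _) _ (ε • shift u w g), map_smul (cum _), map_smul (cum _), he]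
    exact Set.subsingleton_singleton.anti hsub
  · rw [← A.score_eq hε nxx' dxx']
    exact A.score_shift_eq_half hu hw hL (by rw [map_sub, hmg, sub_self])

theorem isMoveMonotone (A : Admissible ρ) (hu : StrictMono u) (hw : StrictMono w)
    (hL : ∀ v, mass v = 0 → (1 / 2 ≤ score ρ v ↔ 0 ≤ Finsupp.linearCombination ℝ u v)) :
    IsMoveMonotone fun f => score ρ (shift u w f) where
  min_le_add f h hf hh := by
    rw [map_add]
    exact (A.score_add (mass_shift f) (mass_shift h) ((half_le_score_shift hu hw hL f).2 hf)
      ((half_le_score_shift hu hw hL h).2 hh)).1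
  smul c f hc := by rw [map_smul]; exact A.score_smul (mass_shift f) hc
  le_move := A.score_shift_le_move hu hw hL

theorem ratio_nonneg_iff (hu : StrictMono u) {x y : Lottery} (hxy : x ≠ y) :
    0 ≤ ratio u x y ↔ 0 ≤ expectedUtility u x - expectedUtility u y := by
  rw [ratio, le_div_iff₀ (cdfDist_pos hu hxy), zero_mul]

theorem rule_eq_of_ratio_eq (A : Admissible ρ) (hu : StrictMono u)
    (hL : ∀ v, mass v = 0 → (1 / 2 ≤ score ρ v ↔ 0 ≤ Finsupp.linearCombination ℝ u v))
    {x y x' y' : Lottery} (hxy : x ≠ y) (hxy' : x' ≠ y') (h : ratio u x y = ratio u x' y') :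
    ρ x y = ρ x' y' := by
  classical
  -- The move argument covers only nonnegative mass; swapping the lotteries covers the rest.
  wlog h0 : 0 ≤ ratio u x y generalizing x y x' y'
  · have h1 := this hxy.symm hxy'.symm (by rw [ratio_swap, ratio_swap u x', h])
      (by rw [ratio_swap]; linarith)
    rw [(A.rule x y hxy).2, (A.rule x' y' hxy').2, h1]
  obtain ⟨w, hw, hs⟩ := exists_strictMono_supp_subset {x, y, x', y'}
  have hx := hs x (by simp)
  have hy := hs y (by simp)
  have hx' := hs x' (by simp)
  have hy' := hs y' (by simp)
  obtain ⟨f, hf⟩ := exists_shift_eq_sub hu hw hx hy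
  obtain ⟨g, hg⟩ := exists_shift_eq_sub hu hw hx' hy'
  rw [← A.score_sub hxy, ← A.score_sub hxy', ← hf, ← hg]
  refine (A.isMoveMonotone hu hw hL).eq_of_div_eq (shift_sub_ne_zero hf hxy)
    (shift_sub_ne_zero hg hxy') ?_ ?_
  · rw [← ratio_eq hu hw hx hy hf, ← ratio_eq hu hw hx' hy' hg, h]
  · rwa [← expectedUtility_sub hu hw hf, ← ratio_nonneg_iff hu hxy]

/-! ### The function G -/

/-- The choice probability at the value `r` of the ratio. -/
noncomputable def link (ρ : Lottery → Lottery → ℝ) (u : ℝ → ℝ) (r : ℝ) : ℝ :=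
  score ρ (shift u (fun i => (i : ℝ)) (unitCoord r))

theorem rule_eq_link (A : Admissible ρ) (hu : StrictMono u)
    (hL : ∀ v, mass v = 0 → (1 / 2 ≤ score ρ v ↔ 0 ≤ Finsupp.linearCombination ℝ u v))
    {x y : Lottery} (hxy : x ≠ y) : ρ x y = link ρ u (ratio u x y) := by
  obtain ⟨x', y', ε, hxy', hε, h, hr⟩ :=
    exists_ratio_eq hu (Nat.strictMono_cast (α := ℝ)) (ratio_mem_Icc hu hxy)
  rw [link, A.score_eq hε hxy' h]
  exact A.rule_eq_of_ratio_eq hu hL hxy hxy' hr.symm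

theorem link_neg (A : Admissible ρ) (hu : StrictMono u)
    (hL : ∀ v, mass v = 0 → (1 / 2 ≤ score ρ v ↔ 0 ≤ Finsupp.linearCombination ℝ u v))
    {r : ℝ} (hr : r ∈ Set.Icc (-1 : ℝ) 1) : link ρ u (-r) = 1 - link ρ u r := by
  obtain ⟨x, y, -, hxy, -, -, rfl⟩ := exists_ratio_eq hu (Nat.strictMono_cast (α := ℝ)) hr
  rw [← ratio_swap, ← A.rule_eq_link hu hL hxy, ← A.rule_eq_link hu hL hxy.symm]
  exact (A.rule y x hxy.symm).2

theorem link_lt_link_one (A : Admissible ρ) (hu : StrictMono u)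
    (hL : ∀ v, mass v = 0 → (1 / 2 ≤ score ρ v ↔ 0 ≤ Finsupp.linearCombination ℝ u v))
    {r : ℝ} (hr : -1 ≤ r) (hr1 : r < 1) : link ρ u r < link ρ u 1 := by
  obtain ⟨x, y, -, hxy, -, -, hx⟩ :=
    exists_ratio_eq hu (Nat.strictMono_cast (α := ℝ)) (r := r) ⟨hr, hr1.le⟩
  obtain ⟨x', y', -, hxy', -, -, hx'⟩ :=
    exists_ratio_eq hu (Nat.strictMono_cast (α := ℝ)) (r := 1) (by norm_num)
  rw [← hx, ← hx', ← A.rule_eq_link hu hL hxy, ← A.rule_eq_link hu hL hxy']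
  refine (A.dominance x' y' hxy' ((ratio_eq_one_iff hu hxy').1 hx') x y hxy).2 fun hd => ?_
  rw [(ratio_eq_one_iff hu hxy).2 hd] at hx
  exact hr1.ne' hx

/-- Adding a multiple of the dominant direction, whose score `link ρ u 1` exceeds that at `r`,
strictly raises the score by the strict part of Transitivity. -/
theorem link_lt_link (A : Admissible ρ) (hu : StrictMono u)
    (hL : ∀ v, mass v = 0 → (1 / 2 ≤ score ρ v ↔ 0 ≤ Finsupp.linearCombination ℝ u v))
    {r r' : ℝ} (hr : 0 ≤ r) (hrr : r < r') (hr1 : r' ≤ 1) : link ρ u r < link ρ u r' := by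
  rcases hr1.eq_or_lt with rfl | hr1
  · exact A.link_lt_link_one hu hL (by linarith) hrr
  have hw := Nat.strictMono_cast (α := ℝ)
  have H := A.isMoveMonotone hu hw hL
  have hpos : 0 < 1 - r' := by linarith
  -- This solves (r + s)/(1 + s) = r', the ratio after adding s at coordinate 0; it requires r' < 1.
  set s := (r' - r) / (1 - r') with hs
  have hs0 : 0 < s := div_pos (by linarith) hpos
  have h1 : score ρ (shift u (fun i : ℕ => (i : ℝ)) (Finsupp.single 0 s)) = link ρ u 1 := by
    have he : Finsupp.single 0 s = s • unitCoord 1 := by simp [unitCoord]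
    rw [he, H.smul s _ hs0, link]
  have hlt := A.link_lt_link_one hu hL (by linarith) (hrr.trans hr1)
  have hhalf : 1 / 2 ≤ link ρ u r :=
    (half_le_score_shift hu hw hL _).2 (by rwa [mass_unitCoord])
  have hne : link ρ u r ≠ score ρ (shift u (fun i : ℕ => (i : ℝ)) (Finsupp.single 0 s)) := by
    rw [h1]; exact hlt.ne
  have h2 := (A.score_add (mass_shift (unitCoord r)) (mass_shift (Finsupp.single 0 s)) hhalf
    (by rw [h1]; linarith)).2 hne
  rw [h1, ← link, min_eq_left hlt.le, ← map_add] at h2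
  refine h2.trans_eq ?_
  have hadd : unitCoord r + Finsupp.single 0 s =
      Finsupp.single 0 ((1 + r) / 2 + s) + Finsupp.single 1 (-((1 - r) / 2)) := by
    rw [unitCoord, Finsupp.single_neg, Finsupp.single_add]; abel
  have hm : mass (unitCoord r + Finsupp.single 0 s) = r + s := by
    rw [map_add, mass_unitCoord, mass_single]
  have hn : oneNorm (unitCoord r + Finsupp.single 0 s) = 1 + s := by
    rw [hadd, oneNorm_add_single (by simp), oneNorm_single, abs_neg, abs_of_nonneg (by linarith),
      abs_of_nonneg (by linarith)]
    ring
  have hr' : r' ∈ Set.Icc (-1 : ℝ) 1 := ⟨by linarith, hr1.le⟩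
  refine H.eq_of_div_eq ?_ (unitCoord_ne_zero hr') ?_ ?_
  · intro h0
    rw [h0, map_zero] at hm
    linarith
  · rw [hm, hn, mass_unitCoord, oneNorm_unitCoord hr', div_one, div_eq_iff (by linarith), hs]
    field_simp
    ring
  · rw [hm]; linarith

theorem strictMonoOn_link (A : Admissible ρ) (hu : StrictMono u)
    (hL : ∀ v, mass v = 0 → (1 / 2 ≤ score ρ v ↔ 0 ≤ Finsupp.linearCombination ℝ u v)) :
    StrictMonoOn (link ρ u) (Set.Icc (-1) 1) := by
  intro r hr r' hr' hlt
  have neg : ∀ {s s' : ℝ}, -1 ≤ s → s < s' → s' ≤ 0 → link ρ u s < link ρ u s' := by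
    intro s s' h1 h2 h3
    have h4 := A.link_lt_link hu hL (r := -s') (r' := -s) (by linarith) (by linarith) (by linarith)
    rw [A.link_neg hu hL ⟨by linarith, by linarith⟩,
      A.link_neg hu hL ⟨by linarith, by linarith⟩] at h4
    linarith
  rcases le_or_gt 0 r with h0 | h0
  · exact A.link_lt_link hu hL h0 hlt hr'.2
  · rcases le_or_gt r' 0 with h1 | h1
    · exact neg hr.1 hlt h1
    · exact (neg hr.1 h0 le_rfl).trans (A.link_lt_link hu hL le_rfl h1 hr'.2)

/-- `unitCoord r` runs along the segment from `unitCoord (-1)` to `unitCoord 1` at time (1 + r)/2,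
and has norm 1, so it avoids 0. -/
theorem continuousOn_link (A : Admissible ρ) (hu : StrictMono u) :
    ContinuousOn (link ρ u) (Set.Icc (-1) 1) := by
  have hw := Nat.strictMono_cast (α := ℝ)
  have hunit : ∀ r, unitCoord r =
      (1 - (1 + r) / 2) • unitCoord (-1) + ((1 + r) / 2) • unitCoord 1 := fun r => by
    ext k
    simp only [unitCoord, Finsupp.add_apply, Finsupp.sub_apply, Finsupp.smul_apply, smul_eq_mul,
      Finsupp.single_apply]
    split_ifs <;> ring
  have hseg : ∀ t : ℝ, (1 - t) • shift u (fun i : ℕ => (i : ℝ)) (unitCoord (-1)) +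
      t • shift u (fun i : ℕ => (i : ℝ)) (unitCoord 1) =
        shift u (fun i : ℕ => (i : ℝ)) (unitCoord (2 * t - 1)) := fun t => by
    rw [hunit (2 * t - 1), map_add, map_smul, map_smul]
    congr 3 <;> ring
  have hc := A.continuousOn_score_segment (mass_shift (u := u) (w := fun i : ℕ => (i : ℝ))
    (unitCoord (-1))) (mass_shift (unitCoord 1)) fun t ht h0 => by
      rw [hseg] at h0
      exact unitCoord_ne_zero (r := 2 * t - 1) ⟨by linarith [ht.1], by linarith [ht.2]⟩
        (shift_injective hu hw (h0.trans (map_zero _).symm))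
  have hcomp := hc.comp (f := fun r : ℝ => (1 + r) / 2) (s := Set.Icc (-1) 1)
    (by fun_prop) fun r hr => ⟨by linarith [hr.1], by linarith [hr.2]⟩
  refine hcomp.congr fun r _ => ?_
  simp only [Function.comp_apply, hseg]
  rw [link]
  congr 3
  ring

theorem exists_representation (A : Admissible ρ) : ∃ G u : ℝ → ℝ, IsCDFRepresentation ρ G u := by
  obtain ⟨u, hu, hL⟩ := A.exists_utility
  exact ⟨link ρ u, u, hu, A.continuousOn_link hu, A.strictMonoOn_link hu hL,
    fun x y hxy => A.rule_eq_link hu hL hxy⟩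

end Admissible

end

end LotteryChoice

theorem mainTheorem9 (ρ : LotteryChoice.Lottery → LotteryChoice.Lottery → ℝ)
    (hρ : LotteryChoice.IsBinaryChoiceRule ρ) :
    ((LotteryChoice.Continuity ρ ∧ LotteryChoice.Independence ρ ∧
        LotteryChoice.ModerateTransitivity ρ ∧ LotteryChoice.Dominance ρ ∧
        LotteryChoice.Simplification ρ) ↔
      ∃ G u : ℝ → ℝ, LotteryChoice.IsCDFRepresentation ρ G u) ∧
    (∀ G u G' u' : ℝ → ℝ, LotteryChoice.IsCDFRepresentation ρ G u →
      LotteryChoice.IsCDFRepresentation ρ G' u' →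
      Set.EqOn G' G (Set.Icc (-1) 1) ∧
        ∃ C b : ℝ, 0 < C ∧ ∀ w, u' w = C * u w + b) := by
  refine ⟨⟨?_, ?_⟩, fun G u G' u' h h' => h.unique hρ h'⟩
  · rintro ⟨hc, hi, hm, hd, hs⟩
    exact LotteryChoice.Admissible.exists_representation ⟨hρ, hc, hi, hm, hd, hs⟩
  · rintro ⟨G, u, h⟩
    exact ⟨h.continuity, h.independence, h.moderateTransitivity hρ, h.dominance,
      h.simplification hρ⟩
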